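/- Let $\Gamma$ be a finite set with $N=\operatorname{card}\Gamma>1$. The Dyck inverse monoid is the monoid with zero generated by $\gamma(-),\gamma(+)$ $(\gamma\in\Gamma)$ with the relations $\gamma(-)\gamma(+)=\mathbf 1$ and $\gamma(-)\gamma'(+)=0$ for $\gamma\neq\gamma'$. The Motzkin shift $M_N$ is the subshift with alphabet $\{\gamma(-),\gamma(+):\gamma\in\Gamma\}\cup\{\mathbf 1\}$ that consists of the bi-infinite sequences all of whose finite subwords have a non-zero product in the Dyck inverse monoid. Let $X^{(N,1)}$ be the subshift that is obtained by excluding from $M_N$ the words $$\gamma(+)\gamma'(-),\qquad \gamma(+)\gamma'(+),\qquad \mathbf 1\mathbf 1\gamma(+),\qquad \gamma(-)\mathbf 1\gamma(+),\qquad \gamma,\gamma'\in\Gamma,$$ that is, the set of points of $M_N$ in which none of these words appears. Let $P_n(X^{(N,1)})$ be the set of points $x\in X^{(N,1)}$ with $x_{i+n}=x_i$ for all $i\in\mathbb Z$, let $$\zeta_{X^{(N,1)}}(z)=\exp\Big(\sum_{n\ge 1}\frac{\operatorname{card}P_n(X^{(N,1)})}{n}\,z^n\Big),$$ and let, with the principal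 branch of the square root, $$g(z)=\tfrac12\Big(1-z-\sqrt{(1-z)(1-z-4Nz^3)}\Big).$$ The series in the exponent converges absolutely for all complex $z$ with $|z|<\frac1{2N+1}$, and for every complex $z$ at which it converges absolutely the denominator below does not vanish and $$\zeta_{X^{(N,1)}}(z)=\frac{1-z-g(z)}{\big(1-(N+1)z-g(z)\big)\big((1-Nz^2)(1-z)-g(z)\big)}.$$ -/

import Mathlib

namespace MotzkinSubshift

open SymbolicDynamics.FullShift

section Words

variable {A : Type*}

/-- The word `x_i x_{i+1} … x_{i+n-1}` of length `n` that appears in `x` at position `i`. -/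
def factor (x : ℤ → A) (i : ℤ) (n : ℕ) : List A :=
  List.ofFn fun k : Fin n => x (i + (k : ℕ))

theorem factor_shift (g : ℤ) (x : ℤ → A) (i : ℤ) (n : ℕ) :
    factor (shift g x) i n = factor x (g + i) n := by
  simp [factor, add_assoc]

variable [TopologicalSpace A] [DiscreteTopology A]

theorem isClosed_factor (P : List A → Prop) (i : ℤ) (n : ℕ) :
    IsClosed {x : ℤ → A | P (factor x i n)} := by
  have hc : Continuous fun (x : ℤ → A) (k : Fin n) => x (i + (k : ℕ)) := by fun_prop
  exact (isClosed_discrete {f : Fin n → A | P (List.ofFn f)}).preimage hc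

/-- The subshift of all points of `A^ℤ` all of whose finite subwords satisfy `P`. -/
def ofFactors (P : List A → Prop) : Subshift A ℤ where
  carrier := {x | ∀ (i : ℤ) (n : ℕ), P (factor x i n)}
  isClosed := by
    simp only [Set.ofPred_forall]
    exact isClosed_iInter fun i => isClosed_iInter fun n => isClosed_factor P i n
  mapsTo := fun g x hx i n => by
    rw [factor_shift]
    exact hx (g + i) n

/-- The subshift obtained from `Y` by excluding the words in `F`: it consists of the points of `Y`
in which no word of `F` appears. -/
def exclude (Y : Subshift A ℤ) (F : Set (List A)) : Subshift A ℤ where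
  carrier := Y.carrier ∩ (ofFactors fun w => w ∉ F).carrier
  isClosed := Y.isClosed.inter (ofFactors fun w => w ∉ F).isClosed
  mapsTo := fun g _ hx => ⟨Y.mapsTo g hx.1, (ofFactors fun w => w ∉ F).mapsTo g hx.2⟩

end Words

section Zeta

variable {A : Type*}

/-- `P_n(Y)`: the points of `Y` that have period `n` under the left shift
(not necessarily as least period). -/
def periodicPoints (Y : Set (ℤ → A)) (n : ℕ) : Set (ℤ → A) :=
  {x | x ∈ Y ∧ Function.IsPeriodicPt (shift (1 : ℤ)) n x}

/-- The term `card P_{n+1}(Y) z^{n+1} / (n+1)` of the series in the exponent of the zeta function.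
The index is moved by one so that it runs over `n + 1 = 1, 2, 3, …`. -/
noncomputable def zetaTerm (Y : Set (ℤ → A)) (z : ℂ) (n : ℕ) : ℂ :=
  ((periodicPoints Y (n + 1)).ncard : ℂ) / ((n + 1 : ℕ) : ℂ) * z ^ (n + 1)

/-- The zeta function `ζ_Y(z) = exp (∑_{n ≥ 1} card P_n(Y) z^n / n)`. -/
noncomputable def zeta (Y : Set (ℤ → A)) (z : ℂ) : ℂ :=
  Complex.exp (∑' n : ℕ, zetaTerm Y z n)

end Zeta

section Dyck

variable (Γ : Type*)

/-- The generators `γ(-)`, `γ(+)` of the Dyck inverse monoid. -/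
inductive DyckGenerator
  | minus (γ : Γ)
  | plus (γ : Γ)

variable {Γ}

/-- The generator `a`, in the free monoid with zero on the generators. -/
def freeGen (a : DyckGenerator Γ) : WithZero (FreeMonoid (DyckGenerator Γ)) :=
  ((FreeMonoid.of a : FreeMonoid (DyckGenerator Γ)) : WithZero (FreeMonoid (DyckGenerator Γ)))

/-- The defining relations `γ(-) γ(+) = 1` and `γ(-) γ'(+) = 0` for `γ ≠ γ'`. -/
inductive DyckRel : WithZero (FreeMonoid (DyckGenerator Γ)) →
    WithZero (FreeMonoid (DyckGenerator Γ)) → Prop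
  | same (γ : Γ) : DyckRel (freeGen (.minus γ) * freeGen (.plus γ)) 1
  | diff (γ γ' : Γ) (h : γ ≠ γ') : DyckRel (freeGen (.minus γ) * freeGen (.plus γ')) 0

variable (Γ)

/-- The Dyck inverse monoid (polycyclic monoid) on `Γ`: the monoid with zero presented by the
generators `γ(-)`, `γ(+)` and the relations `γ(-) γ(+) = 1`, `γ(-) γ'(+) = 0` for `γ ≠ γ'`. -/
abbrev DyckMonoid : Type _ :=
  (conGen (DyckRel (Γ := Γ))).Quotient

/-- The zero of the Dyck inverse monoid: the class of the zero of the free monoid with zero. -/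
instance : Zero (DyckMonoid Γ) :=
  ⟨((0 : WithZero (FreeMonoid (DyckGenerator Γ))) : DyckMonoid Γ)⟩

/-- The alphabet `{γ(-), γ(+) : γ ∈ Γ} ∪ {1}` of the Motzkin shift. -/
inductive Symbol
  | minus (γ : Γ)
  | plus (γ : Γ)
  | one

/-- The alphabet carries the discrete topology. -/
instance : TopologicalSpace (Symbol Γ) := ⊥

instance : DiscreteTopology (Symbol Γ) := ⟨rfl⟩

variable {Γ}

/-- The element of the Dyck inverse monoid denoted by a symbol. -/
def Symbol.value : Symbol Γ → DyckMonoid Γ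
  | .minus γ => (freeGen (.minus γ) : DyckMonoid Γ)
  | .plus γ => (freeGen (.plus γ) : DyckMonoid Γ)
  | .one => 1

variable (Γ)

/-- The Motzkin shift: the bi-infinite sequences all of whose finite subwords have a non-zero
product in the Dyck inverse monoid. -/
def motzkinShift : Subshift (Symbol Γ) ℤ :=
  ofFactors fun w => (w.map Symbol.value).prod ≠ 0

/-- The words `γ(+) γ'(-)`, `γ(+) γ'(+)`, `1 1 γ(+)` and `γ(-) 1 γ(+)`, for `γ, γ' ∈ Γ`. -/
def excludedWords : Set (List (Symbol Γ)) :=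
  {w | (∃ γ γ' : Γ, w = [.plus γ, .minus γ']) ∨ (∃ γ γ' : Γ, w = [.plus γ, .plus γ']) ∨
    (∃ γ : Γ, w = [.one, .one, .plus γ]) ∨ (∃ γ : Γ, w = [.minus γ, .one, .plus γ])}

/-- The subshift `X^{(N,1)}`, `N = card Γ`. -/
def shiftX : Subshift (Symbol Γ) ℤ :=
  exclude (motzkinShift Γ) (excludedWords Γ)

end Dyck

/-- `g(z) = (1 - z - √((1 - z) (1 - z - 4 N z³))) / 2`, with the principal square root. -/
noncomputable def gFun (N : ℕ) (z : ℂ) : ℂ :=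
  (1 - z - Complex.sqrt ((1 - z) * (1 - z - 4 * N * z ^ 3))) / 2

end MotzkinSubshift

namespace MotzkinSubshift

open SymbolicDynamics.FullShift

/-! ### The Dyck monoid acting on infinite stacks -/

section Monoid

variable {Γ : Type*}

/-! Let the height rise at γ(-) and fall at γ(+). A point lies in the Motzkin shift exactly when
matched brackets carry equal labels (`compatible_of_mem_motzkinShift`,
`Compatible.mem_motzkinShift`). In a cyclic word with a symbols γ(-) and b symbols γ(+), every
bracket of the rarer kind is matched, so the labels of the commoner kind are free: each pattern of
types has N^max(a,b) labelings (`ncard_motzkinShift_of_shape`). The excluded words then restrict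
only the pattern.

Write N^max(a,b) = N^a · N^max(b-a,0). With y^(a-b) in place of the second factor the weight is
multiplicative along the word, and a four-state transfer matrix shows that for |y| = 1 the
exponential of the resulting series is 1/D(y), where D(y) = (1-z)(1-z²/y) - Nyz
(`exp_tsum_term_mul_zpow`). Replacing y^k by N^max(-k,0) is linear but not multiplicative, so it has
to act on log D. The factorization D(y) = C(1-py)(1-q/y) with C = 1-z-g(z) makes -log D an explicit
Laurent series, and the replacement turns it into -log of C(1-p)(1-qN). This is the claimed formula.

Two facts carry the argument. `exp_weighted_eq` transfers the replacement between exponents that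
agree only modulo 2πi. `norm_bounds_of_sqrt` gives |p| < 1 and |qN| < 1, so the principal root is
the right one; its hypothesis, D(1) > 0 with |z| in place of z, follows from absolute convergence
alone (`determinant_norm_pos`). -/

theorem DyckMonoid.zero_mul (a : DyckMonoid Γ) : 0 * a = 0 := by
  induction a using Con.induction_on with
  | H a =>
    change (((0 * a : WithZero (FreeMonoid (DyckGenerator Γ))) : DyckMonoid Γ)) = _
    rw [MulZeroClass.zero_mul]
    rfl

theorem DyckMonoid.mul_zero (a : DyckMonoid Γ) : a * 0 = 0 := by
  induction a using Con.induction_on with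
  | H a =>
    change (((a * 0 : WithZero (FreeMonoid (DyckGenerator Γ))) : DyckMonoid Γ)) = _
    rw [MulZeroClass.mul_zero]
    rfl

theorem Symbol.value_minus_mul_plus_same (γ : Γ) :
    (Symbol.minus γ).value * (Symbol.plus γ).value = 1 :=
  Quotient.sound (Con.le_conGen _ _ (DyckRel.same γ))

theorem Symbol.value_minus_mul_plus_diff {γ δ : Γ} (h : γ ≠ δ) :
    (Symbol.minus γ).value * (Symbol.plus δ).value = 0 :=
  Quotient.sound (Con.le_conGen _ _ (DyckRel.diff γ δ h))

/-- An infinite stack with a new top entry. -/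
def push (γ : Γ) (s : ℕ → Γ) : ℕ → Γ
  | 0 => γ
  | t + 1 => s t

open Classical in
/-- The action of the generators on the free abelian group on infinite stacks:
`γ(+)` pushes `γ` and `γ(-)` pops `γ`. -/
noncomputable def genAction : DyckGenerator Γ → Module.End ℤ ((ℕ → Γ) →₀ ℤ)
  | .plus γ => Finsupp.linearCombination ℤ fun s => Finsupp.single (push γ s) 1
  | .minus γ => Finsupp.linearCombination ℤ fun s =>
      if s 0 = γ then Finsupp.single (fun t => s (t + 1)) 1 else 0

/-- The action of the free monoid with zero on infinite stacks. -/
noncomputable def freeAction :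
    WithZero (FreeMonoid (DyckGenerator Γ)) →* Module.End ℤ ((ℕ → Γ) →₀ ℤ) :=
  (WithZero.lift' (FreeMonoid.lift genAction)).toMonoidHom

theorem freeAction_freeGen (a : DyckGenerator Γ) : freeAction (freeGen a) = genAction a := by
  simp [freeAction, freeGen]

theorem freeAction_zero : freeAction (0 : WithZero (FreeMonoid (DyckGenerator Γ))) = 0 := by
  simp [freeAction]

/-- Working linearly makes a failed pop the zero map, so the zero of the monoid acts as zero and any
product that acts nontrivially is nonzero. -/
theorem conGen_le_ker_freeAction : conGen (DyckRel (Γ := Γ)) ≤ Con.ker freeAction := by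
  rw [Con.conGen_le]
  rintro _ _ (⟨γ⟩ | ⟨γ, δ, h⟩)
  · change freeAction _ = freeAction _
    rw [map_mul, freeAction_freeGen, freeAction_freeGen, map_one]
    refine Finsupp.lhom_ext fun s c => ?_
    simp [genAction, push]
  · change freeAction _ = freeAction _
    rw [map_mul, freeAction_freeGen, freeAction_freeGen, freeAction_zero]
    refine Finsupp.lhom_ext fun s c => ?_
    simp [genAction, push, h.symm]

/-- The action of the Dyck inverse monoid on infinite stacks. -/
noncomputable def stackAction : DyckMonoid Γ →* Module.End ℤ ((ℕ → Γ) →₀ ℤ) :=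
  Con.lift _ freeAction conGen_le_ker_freeAction

theorem stackAction_zero : stackAction (0 : DyckMonoid Γ) = 0 :=
  freeAction_zero

theorem stackAction_plus (γ : Γ) (s : ℕ → Γ) :
    stackAction (Symbol.plus γ).value (Finsupp.single s 1) = Finsupp.single (push γ s) 1 := by
  change freeAction (freeGen _) _ = _
  rw [freeAction_freeGen]
  simp [genAction]

theorem stackAction_minus (γ : Γ) (s : ℕ → Γ) :
    stackAction (Symbol.minus γ).value (Finsupp.single (push γ s) 1) = Finsupp.single s 1 := by
  change freeAction (freeGen _) _ = _
  rw [freeAction_freeGen]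
  simp [genAction, push]

end Monoid

/-! ### Splitting factors at either end -/

section Factor

variable {A : Type*}

theorem factor_succ (x : ℤ → A) (i : ℤ) (n : ℕ) :
    factor x i (n + 1) = x i :: factor x (i + 1) n := by
  simp only [factor, List.ofFn_succ, Fin.val_zero, Nat.cast_zero, add_zero, Fin.val_succ,
    Nat.cast_add, Nat.cast_one]
  congr 2
  funext k
  congr 1
  ring

theorem factor_succ_last (x : ℤ → A) (i : ℤ) (n : ℕ) :
    factor x i (n + 1) = factor x i n ++ [x (i + n)] := by
  simp only [factor, List.ofFn_succ', List.concat_eq_append, Fin.val_castSucc, Fin.val_last]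

end Factor

/-! ### Membership in the Motzkin shift as bracket matching -/

section Matching

variable {Γ : Type*}

/-- The change of height caused by a symbol: `γ(-)` raises and `γ(+)` lowers the height. -/
def Symbol.step : Symbol Γ → ℤ
  | .minus _ => 1
  | .plus _ => -1
  | .one => 0

/-- `H` is a height function of `x`. -/
def IsHeight (x : ℤ → Symbol Γ) (H : ℤ → ℤ) : Prop :=
  ∀ k, H (k + 1) = H k + (x k).step

/-- Whenever `γ(-)` is matched with `δ(+)` in `x`, then `γ = δ`. -/
def Compatible (x : ℤ → Symbol Γ) (H : ℤ → ℤ) : Prop :=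
  ∀ i j γ δ, i < j → x i = .minus γ → x j = .plus δ → H (j + 1) = H i →
    (∀ k, i < k → k ≤ j → H i < H k) → γ = δ

/-- A word acts from its right end, so `S (k + 1)` is the input and `S k` the output of the symbol
at `k`; the whole factor then carries one basis vector to another. -/
theorem prod_ne_zero_of_stacks (x : ℤ → Symbol Γ) (S : ℤ → ℕ → Γ)
    (hS : ∀ k, stackAction (x k).value (Finsupp.single (S (k + 1)) 1) = Finsupp.single (S k) 1)
    (i : ℤ) (n : ℕ) : ((factor x i n).map Symbol.value).prod ≠ 0 := by
  have key : ∀ (n : ℕ) (i : ℤ), stackAction ((factor x i n).map Symbol.value).prod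
      (Finsupp.single (S (i + n)) 1) = Finsupp.single (S i) 1 := by
    intro n
    induction n with
    | zero => intro i; simp [factor]
    | succ n ih =>
      intro i
      rw [factor_succ, List.map_cons, List.prod_cons, map_mul, Module.End.mul_apply,
        show i + ((n + 1 : ℕ) : ℤ) = i + 1 + n by push_cast; ring, ih, hS]
  intro h
  have := key n i
  rw [h, stackAction_zero, LinearMap.zero_apply] at this
  exact one_ne_zero (Finsupp.single_eq_zero.1 this.symm)

/-- The position is the last one up to `b` with height at most `l`; steps have size at most one, so
no level is skipped. -/
theorem IsHeight.exists_upcrossing {x : ℤ → Symbol Γ} {H : ℤ → ℤ} (hH : IsHeight x H) {a b l : ℤ}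
    (hab : a ≤ b) (ha : H a ≤ l) (hb : l < H b) :
    ∃ i, a ≤ i ∧ i < b ∧ H i = l ∧ H (i + 1) = l + 1 ∧ ∀ k, i < k → k ≤ b → l < H k := by
  obtain ⟨i, ⟨hi1, hi2⟩, hi3⟩ := Int.exists_greatest_of_bdd (P := fun i => i ≤ b ∧ H i ≤ l)
    ⟨b, fun _ h => h.1⟩ ⟨a, hab, ha⟩
  have hib : i ≠ b := by rintro rfl; omega
  have hlt : ∀ k, i < k → k ≤ b → l < H k := fun k hik hkb => by
    by_contra! h
    have := hi3 k ⟨hkb, h⟩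
    omega
  have h1 := hlt (i + 1) (by omega) (by omega)
  have h2 := hH i
  have h3 := hi3 a ⟨hab, ha⟩
  refine ⟨i, h3, by omega, ?_⟩
  rcases hx : x i <;> simp only [hx, Symbol.step] at h2 <;> refine ⟨?_, ?_, hlt⟩ <;> omega

theorem IsHeight.exists_downcrossing {x : ℤ → Symbol Γ} {H : ℤ → ℤ} (hH : IsHeight x H)
    {a b l : ℤ} (hab : a ≤ b) (ha : l < H a) (hb : H b ≤ l) :
    ∃ j, a ≤ j ∧ j < b ∧ H j = l + 1 ∧ H (j + 1) = l ∧ ∀ k, a ≤ k → k ≤ j → l < H k := by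
  obtain ⟨m, ⟨hm1, hm2⟩, hm3⟩ := Int.exists_least_of_bdd (P := fun i => a ≤ i ∧ H i ≤ l)
    ⟨a, fun _ h => h.1⟩ ⟨b, hab, hb⟩
  have hma : m ≠ a := by rintro rfl; omega
  have hlt : ∀ k, a ≤ k → k ≤ m - 1 → l < H k := fun k hak hkm => by
    by_contra! h
    have := hm3 k ⟨hak, h⟩
    omega
  have h1 := hlt (m - 1) (by omega) (by omega)
  have h2 := hH (m - 1)
  have h3 := hm3 b ⟨hab, hb⟩
  rw [show m - 1 + 1 = m by ring] at h2
  refine ⟨m - 1, by omega, by omega, ?_⟩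
  rw [show m - 1 + 1 = m by ring]
  rcases hx : x (m - 1) <;> simp only [hx, Symbol.step] at h2 <;> refine ⟨?_, ?_, hlt⟩ <;> omega

/-- The label of a symbol, with a default value for `1`. -/
def Symbol.label (d : Γ) : Symbol Γ → Γ
  | .minus γ => γ
  | .plus γ => γ
  | .one => d

theorem IsHeight.eq_minus {x : ℤ → Symbol Γ} {H : ℤ → ℤ} (hH : IsHeight x H) {k : ℤ}
    (h : H (k + 1) = H k + 1) (d : Γ) : x k = .minus ((x k).label d) := by
  have := hH k
  rcases hx : x k <;> simp only [hx, Symbol.step, Symbol.label] at this ⊢ <;> omega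

theorem IsHeight.eq_plus {x : ℤ → Symbol Γ} {H : ℤ → ℤ} (hH : IsHeight x H) {k : ℤ}
    (h : H (k + 1) = H k - 1) (d : Γ) : x k = .plus ((x k).label d) := by
  have := hH k
  rcases hx : x k <;> simp only [hx, Symbol.step, Symbol.label] at this ⊢ <;> omega

/-- The positions before `k` at which the height rises from `l` to `l + 1`. -/
def opens (H : ℤ → ℤ) (k l : ℤ) : Set ℤ :=
  {i | i < k ∧ H i = l ∧ H (i + 1) = l + 1}

/-- The positions from `k` on at which the height falls from `l + 1` to `l`. -/
def closes (H : ℤ → ℤ) (k l : ℤ) : Set ℤ :=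
  {j | k ≤ j ∧ H j = l + 1 ∧ H (j + 1) = l}

open Classical in
/-- The stack entry at level `l` between positions `k - 1` and `k`. -/
noncomputable def entry (d : Γ) (x : ℤ → Symbol Γ) (H : ℤ → ℤ) (k l : ℤ) : Γ :=
  if (opens H k l).Nonempty then (x (sSup (opens H k l))).label d
  else (x (sInf (closes H k l))).label d

/-- The step at `k` can open or close level `l` only if one of its end heights is `l`. As the sets
themselves agree, the default entry of a level never opened or closed is constant too. -/
theorem entry_succ (d : Γ) (x : ℤ → Symbol Γ) (H : ℤ → ℤ) (k l : ℤ) (h1 : l ≠ H k)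
    (h2 : l ≠ H (k + 1)) : entry d x H (k + 1) l = entry d x H k l := by
  have ho : opens H (k + 1) l = opens H k l := by
    ext i
    simp only [opens, Set.mem_ofPred_eq]
    refine ⟨fun ⟨a, b, c⟩ => ⟨?_, b, c⟩, fun ⟨a, b, c⟩ => ⟨by omega, b, c⟩⟩
    rcases (show i < k ∨ i = k by omega) with h | rfl
    · exact h
    · exact absurd b.symm h1
  have hc : closes H (k + 1) l = closes H k l := by
    ext j
    simp only [closes, Set.mem_ofPred_eq]
    refine ⟨fun ⟨a, b, c⟩ => ⟨by omega, b, c⟩, fun ⟨a, b, c⟩ => ⟨?_, b, c⟩⟩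
    rcases (show k + 1 ≤ j ∨ j = k by omega) with h | rfl
    · exact h
    · exact absurd c.symm h2
  rw [entry, entry, ho, hc]

theorem entry_minus (d : Γ) (x : ℤ → Symbol Γ) (H : ℤ → ℤ) (k : ℤ) (h : H (k + 1) = H k + 1) :
    entry d x H (k + 1) (H k) = (x k).label d := by
  have hg : IsGreatest (opens H (k + 1) (H k)) k :=
    ⟨⟨by omega, rfl, h⟩, fun i hi => by have := hi.1; omega⟩
  rw [entry, if_pos ⟨k, hg.1⟩, hg.csSup_eq]

/-- If the level was opened before, its last opening is matched with `k` and compatibility equates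
the labels; otherwise `k` itself is the first closing. -/
theorem entry_plus (d : Γ) (x : ℤ → Symbol Γ) (H : ℤ → ℤ) (hH : IsHeight x H)
    (hc : Compatible x H) (k : ℤ) (h : H (k + 1) = H k - 1) :
    entry d x H k (H k - 1) = (x k).label d := by
  rw [entry]
  split_ifs with ho
  · have hb : BddAbove (opens H k (H k - 1)) := ⟨k, fun i hi => hi.1.le⟩
    obtain ⟨h1, h2, h3⟩ := Int.csSup_mem ho hb
    set i := sSup (opens H k (H k - 1)) with hi
    refine hc i k _ _ h1 (hH.eq_minus (by omega) d) (hH.eq_plus h d) (by omega) ?_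
    intro m him hmk
    -- A return to the level after `i` would force a later opening before `k`, against the
    -- maximality of `i`.
    by_contra! hm
    obtain ⟨m', hm1, hm2, hm3, hm4, -⟩ := hH.exists_upcrossing hmk (hm.trans h2.le) (by omega)
    have : m' ≤ i := le_csSup hb ⟨hm2, hm3, hm4⟩
    omega
  · have hl : IsLeast (closes H k (H k - 1)) k :=
      ⟨⟨le_rfl, by omega, by omega⟩, fun i hi => hi.1⟩
    rw [hl.csInf_eq]

theorem Compatible.mem_motzkinShift [Nonempty Γ] {x : ℤ → Symbol Γ} {H : ℤ → ℤ}
    (hH : IsHeight x H) (hc : Compatible x H) : x ∈ (motzkinShift Γ).carrier := by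
  obtain ⟨d⟩ := ‹Nonempty Γ›
  -- The top of the stack at time `k` sits at level `H k - 1`, and depth `t` lies `t` levels below.
  refine prod_ne_zero_of_stacks x (fun k t => entry d x H k (H k - 1 - t)) fun k => ?_
  have hk := hH k
  rcases hx : x k with γ | γ | _ <;> simp only [hx, Symbol.step] at hk
  · convert stackAction_minus γ (fun t => entry d x H k (H k - 1 - t)) using 3
    funext t
    cases t with
    | zero =>
      rw [show H (k + 1) - 1 - ((0 : ℕ) : ℤ) = H k by simp [hk], entry_minus d x H k hk, hx]
      rfl
    | succ t =>
      rw [show H (k + 1) - 1 - ((t + 1 : ℕ) : ℤ) = H k - 1 - t by push_cast; omega]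
      exact entry_succ d x H k _ (by omega) (by omega)
  · rw [stackAction_plus]
    congr 1
    funext t
    cases t with
    | zero =>
      have h := entry_plus d x H hH hc k (by omega)
      rw [show H k - 1 - ((0 : ℕ) : ℤ) = H k - 1 by simp, h, hx]
      rfl
    | succ t =>
      rw [show H k - 1 - ((t + 1 : ℕ) : ℤ) = H (k + 1) - 1 - t by push_cast; omega]
      exact entry_succ d x H k _ (by omega) (by omega)
  · rw [show (Symbol.one : Symbol Γ).value = 1 from rfl, map_one, Module.End.one_apply]
    congr 1
    funext t
    rw [show H (k + 1) = H k by omega]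
    exact entry_succ d x H k _ (by omega) (by omega)

/-- As long as the height stays above its start, each γ(+) meets a surviving γ(-) and must cancel
it, since a label mismatch would make the product zero. -/
theorem exists_prod_eq_minus {x : ℤ → Symbol Γ} {H : ℤ → ℤ} (hH : IsHeight x H)
    (hx : x ∈ (motzkinShift Γ).carrier) (i : ℤ) (n : ℕ)
    (hle : ∀ m : ℕ, m ≤ n → H i ≤ H (i + m)) :
    ∃ L : List Γ, (L.length : ℤ) = H (i + n) - H i ∧
      ((factor x i n).map Symbol.value).prod = (L.map fun γ => (Symbol.minus γ).value).prod := by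
  induction n with
  | zero => exact ⟨[], by simp, by simp [factor]⟩
  | succ n ih =>
    obtain ⟨L, hL, hp⟩ := ih fun m hm => hle m (by omega)
    have hne : ((factor x i (n + 1)).map Symbol.value).prod ≠ 0 := hx i (n + 1)
    have hk := hH (i + n)
    have hlast := hle (n + 1) le_rfl
    have hin : i + ((n + 1 : ℕ) : ℤ) = i + n + 1 := by push_cast; ring
    rw [factor_succ_last, List.map_append, List.prod_append, hp] at hne ⊢
    rw [hin] at hlast ⊢
    simp only [List.map_cons, List.map_nil, List.prod_singleton] at hne ⊢
    rcases hxk : x (i + n) with γ | γ | _ <;> simp only [hxk, Symbol.step] at hk hne ⊢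
    · exact ⟨L ++ [γ], by simp; omega, by simp⟩
    · rcases L.eq_nil_or_concat with rfl | ⟨L', δ, rfl⟩
      · simp at hL; omega
      · simp only [List.concat_eq_append, List.map_append, List.map_cons, List.map_nil,
          List.prod_append, List.prod_singleton, List.length_append, List.length_singleton,
          mul_assoc] at hne hL ⊢
        by_cases hδ : δ = γ
        · subst hδ
          refine ⟨L', by push_cast at hL; omega, ?_⟩
          rw [Symbol.value_minus_mul_plus_same, mul_one]
        · rw [Symbol.value_minus_mul_plus_diff hδ, DyckMonoid.mul_zero] at hne
          exact absurd rfl hne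
    · exact ⟨L, by omega, by rw [show (Symbol.one : Symbol Γ).value = 1 from rfl, mul_one]⟩

/-- What lies strictly between matched brackets has product 1, so the two brackets are multiplied
directly. -/
theorem compatible_of_mem_motzkinShift {x : ℤ → Symbol Γ} {H : ℤ → ℤ} (hH : IsHeight x H)
    (hx : x ∈ (motzkinShift Γ).carrier) : Compatible x H := by
  intro i j γ δ hij hi hj hH' hk
  obtain ⟨n, rfl⟩ : ∃ n : ℕ, j = i + 1 + n := ⟨(j - i - 1).toNat, by omega⟩
  have h1 := hH i
  have h2 := hH (i + 1 + n)
  simp only [hi, hj, Symbol.step] at h1 h2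
  obtain ⟨L, hL, hp⟩ := exists_prod_eq_minus hH hx (i + 1) n fun m hm => by
    have := hk (i + 1 + m) (by omega) (by omega)
    omega
  have hL0 : L = [] := List.length_eq_zero_iff.1 (by omega)
  have hne : ((factor x i (n + 1 + 1)).map Symbol.value).prod ≠ 0 := hx i (n + 1 + 1)
  rw [factor_succ, factor_succ_last, List.map_cons, List.map_append, List.prod_cons,
    List.prod_append, hp, hL0, hi, hj] at hne
  by_contra h
  simp [Symbol.value_minus_mul_plus_diff h] at hne

end Matching

/-! ### Symbols as types with labels -/

/-- The types of the symbols of the Motzkin shift. -/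
inductive Shape
  | minus
  | plus
  | one
  deriving DecidableEq

instance : Fintype Shape where
  elems := {.minus, .plus, .one}
  complete s := by cases s <;> simp

/-- The change of height caused by a symbol of the given type. -/
def Shape.step : Shape → ℤ
  | .minus => 1
  | .plus => -1
  | .one => 0

section Build

variable {Γ : Type*}

/-- The type of a symbol. -/
def Symbol.shape : Symbol Γ → Shape
  | .minus _ => .minus
  | .plus _ => .plus
  | .one => .one

theorem Symbol.step_shape (a : Symbol Γ) : a.shape.step = a.step := by
  cases a <;> rfl

/-- The symbol of a given type with a given label. -/
def Shape.build : Shape → Γ → Symbol Γ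
  | .minus, γ => .minus γ
  | .plus, γ => .plus γ
  | .one, _ => .one

theorem Shape.shape_build (s : Shape) (γ : Γ) : (s.build γ).shape = s := by
  cases s <;> rfl

theorem Symbol.build_shape_label (d : Γ) (a : Symbol Γ) : a.shape.build (a.label d) = a := by
  cases a <;> rfl

theorem Shape.build_injective {s : Shape} (h : s ≠ .one) :
    Function.Injective (s.build : Γ → Symbol Γ) := by
  intro γ δ e
  cases s <;> simp_all [Shape.build]

/-- Symbols are labels with one of two types, or `1`. -/
def Symbol.equivSum : Symbol Γ ≃ Γ ⊕ Γ ⊕ Unit where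
  toFun
    | .minus γ => .inl γ
    | .plus γ => .inr (.inl γ)
    | .one => .inr (.inr ())
  invFun
    | .inl γ => .minus γ
    | .inr (.inl γ) => .plus γ
    | .inr (.inr _) => .one
  left_inv a := by cases a <;> rfl
  right_inv a := by rcases a with a | a | a <;> rfl

instance [Finite Γ] : Finite (Symbol Γ) := Finite.of_equiv _ Symbol.equivSum.symm

theorem Symbol.natCard [Finite Γ] : Nat.card (Symbol Γ) = 2 * Nat.card Γ + 1 := by
  rw [Nat.card_congr Symbol.equivSum, Nat.card_sum, Nat.card_sum, Nat.card_eq_fintype_card (α := Unit), Fintype.card_unit]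
  ring

end Build

/-! ### Periodic points as cyclic words -/

section Unroll

variable {A : Type*} {n : ℕ}

/-- The point of period `n` given by a cyclic word of length `n`. -/
def unroll (u : ZMod n → A) : ℤ → A := fun i => u i

theorem unroll_injective : Function.Injective (unroll : (ZMod n → A) → ℤ → A) := by
  intro u v h
  funext c
  obtain ⟨i, rfl⟩ := ZMod.intCast_surjective c
  exact congrFun h i

theorem iterate_shift_one (x : ℤ → A) (n : ℕ) (i : ℤ) :
    ((shift (1 : ℤ))^[n] x) i = x (n + i) := by
  induction n generalizing i with
  | zero => simp
  | succ n ih =>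
    rw [Function.iterate_succ_apply', shift_apply, ih]
    congr 1
    push_cast
    ring

theorem mem_range_unroll_iff (x : ℤ → A) :
    x ∈ Set.range (unroll : (ZMod n → A) → ℤ → A) ↔ Function.IsPeriodicPt (shift (1 : ℤ)) n x := by
  constructor
  · rintro ⟨u, rfl⟩
    funext i
    rw [iterate_shift_one]
    simp [unroll]
  · intro h
    have hp : Function.Periodic x n := fun i => by
      rw [add_comm, ← iterate_shift_one x n i, h]
    refine ⟨fun c => x (Function.surjInv ZMod.intCast_surjective c), ?_⟩
    funext i
    have hi := Function.surjInv_eq ZMod.intCast_surjective (i : ZMod n)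
    rw [ZMod.intCast_eq_intCast_iff_dvd_sub] at hi
    obtain ⟨t, ht⟩ := hi
    change x _ = x i
    rw [← hp.int_mul t]
    congr 1
    simp only [Int.cast_id]
    linarith [mul_comm t (n : ℤ)]

theorem ncard_periodicPoints (Y : Set (ℤ → A)) (n : ℕ) :
    (periodicPoints Y n).ncard = {u : ZMod n → A | unroll u ∈ Y}.ncard := by
  rw [← Set.ncard_image_of_injective _ unroll_injective]
  congr 1
  ext x
  constructor
  · rintro ⟨hx, hp⟩
    obtain ⟨u, rfl⟩ := (mem_range_unroll_iff x).2 hp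
    exact ⟨u, hx, rfl⟩
  · rintro ⟨u, hu, rfl⟩
    exact ⟨hu, (mem_range_unroll_iff _).1 ⟨u, rfl⟩⟩

end Unroll

/-! ### Height functions of cyclic words -/

section Height

variable {n : ℕ} [NeZero n]

/-- The number of positions of a given type in a cyclic word. -/
def count (f : ZMod n → Shape) (s : Shape) : ℕ :=
  (Finset.univ.filter fun c => f c = s).card

theorem sum_step (f : ZMod n → Shape) :
    ∑ i ∈ Finset.range n, (f (i : ZMod n)).step = (count f .minus : ℤ) - count f .plus := by
  have h1 : ∑ i ∈ Finset.range n, (f (i : ZMod n)).step = ∑ c : ZMod n, (f c).step := by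
    refine Finset.sum_nbij' (fun i => (i : ZMod n)) ZMod.val ?_ ?_ ?_ ?_ ?_
    · simp
    · intro c _
      simpa using ZMod.val_lt c
    · intro i hi
      exact ZMod.val_cast_of_lt (by simpa using hi)
    · intro c _
      simp
    · simp
  have h2 : ∀ s : Shape, s.step = (if s = .minus then 1 else 0) - (if s = .plus then 1 else 0) := by
    rintro (_ | _ | _) <;> simp [Shape.step]
  rw [h1, count, count, Finset.card_filter, Finset.card_filter]
  simp_rw [h2]
  push_cast
  rw [Finset.sum_sub_distrib]

/-- Partial sums over one period are extended by adding the net gain of a period for each period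
passed. -/
theorem exists_height (f : ZMod n → Shape) :
    ∃ H : ℤ → ℤ, (∀ k, H (k + 1) = H k + (f k).step) ∧
      ∀ k t, H (k + t * n) = H k + t * ((count f .minus : ℤ) - count f .plus) := by
  rw [← sum_step f]
  set σ : ℕ → ℤ := fun m => ∑ i ∈ Finset.range m, (f (i : ZMod n)).step with hσ
  have hn : (0 : ℤ) < n := by exact_mod_cast NeZero.pos n
  set H : ℤ → ℤ := fun k => k / n * σ n + σ (k % n).toNat with hHdef
  have h1 : ∀ (q : ℤ) (r : ℕ), r < n → H (q * n + r) = q * σ n + σ r := by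
    intro q r hr
    have e1 : (q * n + r) / (n : ℤ) = q := by
      rw [add_comm, Int.add_mul_ediv_right _ _ hn.ne', Int.ediv_eq_zero_of_lt] <;> omega
    have e2 : (q * n + r) % (n : ℤ) = r := by
      rw [add_comm, Int.add_mul_emod_self_right, Int.emod_eq_of_lt] <;> omega
    simp only [hHdef, e1, e2, Int.toNat_natCast]
  -- Admitting `r = n` removes the special case of a step across a period boundary.
  have h2 : ∀ (q : ℤ) (r : ℕ), r ≤ n → H (q * n + r) = q * σ n + σ r := by
    intro q r hr
    rcases hr.lt_or_eq with h | h
    · exact h1 q r h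
    · have := h1 (q + 1) 0 (NeZero.pos n)
      subst h
      rw [show q * (r : ℤ) + r = (q + 1) * r + (0 : ℕ) by push_cast; ring, this]
      simp only [hσ, Finset.range_zero, Finset.sum_empty]
      ring
  have h3 : ∀ k : ℤ, ∃ (q : ℤ) (r : ℕ), r < n ∧ k = q * n + r := fun k =>
    ⟨k / n, (k % n).toNat, by have := Int.emod_lt_of_pos k hn; have := Int.emod_nonneg k hn.ne'; omega,
      by rw [Int.toNat_of_nonneg (Int.emod_nonneg k hn.ne'), mul_comm, Int.mul_ediv_add_emod]⟩
  refine ⟨H, fun k => ?_, fun k t => ?_⟩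
  · obtain ⟨q, r, hr, rfl⟩ := h3 k
    have := h2 q (r + 1) hr
    push_cast at this
    rw [add_assoc, this, h1 q r hr]
    simp [hσ, Finset.sum_range_succ, add_assoc]
  · obtain ⟨q, r, hr, rfl⟩ := h3 k
    rw [show q * (n : ℤ) + r + t * n = (q + t) * n + r by ring, h1 _ r hr, h1 _ r hr]
    ring

end Height

/-! ### Matched positions and labelings constant along a matching -/

section Matched

/-- The positions `i` and `j` are matched with respect to the height function `H`. -/
def Matched (H : ℤ → ℤ) (i j : ℤ) : Prop :=
  i < j ∧ H (j + 1) = H i ∧ ∀ k, i < k → k ≤ j → H i < H k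

theorem Matched.eq_left {H : ℤ → ℤ} {i i' j : ℤ} (h : Matched H i j) (h' : Matched H i' j) :
    i = i' := by
  obtain ⟨h1, h2, h3⟩ := h
  obtain ⟨h1', h2', h3'⟩ := h'
  rcases lt_trichotomy i i' with hlt | heq | hgt
  · have := h3 i' hlt h1'.le
    omega
  · exact heq
  · have := h3' i hgt h1.le
    omega

theorem Matched.eq_right {H : ℤ → ℤ} {i j j' : ℤ} (h : Matched H i j) (h' : Matched H i j') :
    j = j' := by
  obtain ⟨h1, h2, h3⟩ := h
  obtain ⟨h1', h2', h3'⟩ := h'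
  rcases lt_trichotomy j j' with hlt | heq | hgt
  · have := h3' (j + 1) (by omega) (by omega)
    omega
  · exact heq
  · have := h3 (j' + 1) (by omega) (by omega)
    omega

theorem Matched.translate {H : ℤ → ℤ} {i j p d : ℤ} (hp : ∀ k t, H (k + t * p) = H k + t * d)
    (h : Matched H i j) (t : ℤ) : Matched H (i + t * p) (j + t * p) := by
  obtain ⟨h1, h2, h3⟩ := h
  refine ⟨by omega, ?_, fun k hk1 hk2 => ?_⟩
  · rw [show j + t * p + 1 = j + 1 + t * p by ring, hp, hp, h2]
  · have := h3 (k - t * p) (by omega) (by omega)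
    have e := hp (k - t * p) t
    rw [sub_add_cancel] at e
    rw [hp, e]
    omega

/-- The number of labelings that are constant along a relation which attaches every constrained
point to exactly one free point. -/
theorem natCard_labelings {W Γ : Type*} [Finite W] (p : W → Prop)
    (R : W → W → Prop) (hR : ∀ w w', R w w' → ¬ p w ∧ p w') (hex : ∀ w, ¬ p w → ∃ w', R w w')
    (huniq : ∀ w w' w'', R w w' → R w w'' → w' = w'') :
    Nat.card {φ : W → Γ // ∀ w w', R w w' → φ w = φ w'} = Nat.card Γ ^ Nat.card {w // p w} := by
  rw [← Nat.card_fun]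
  refine Nat.card_eq_of_bijective (fun φ (w : {w // p w}) => φ.1 w.1) ⟨?_, ?_⟩
  · rintro ⟨φ, hφ⟩ ⟨ψ, hψ⟩ h
    refine Subtype.ext (funext fun w => ?_)
    by_cases hw : p w
    · exact congrFun h ⟨w, hw⟩
    · obtain ⟨w', hw'⟩ := hex w hw
      change φ w = ψ w
      rw [hφ w w' hw', hψ w w' hw']
      exact congrFun h ⟨w', (hR w w' hw').2⟩
  · intro θ
    choose m hm using hex
    classical
    refine ⟨⟨fun w => if hw : p w then θ ⟨w, hw⟩ else θ ⟨m w hw, (hR _ _ (hm w hw)).2⟩,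
      fun w w' hww' => ?_⟩, ?_⟩
    · obtain ⟨h1, h2⟩ := hR w w' hww'
      dsimp only
      rw [dif_neg h1, dif_pos h2]
      congr 2
      exact huniq w _ _ (hm w h1) hww'
    · funext w
      exact dif_pos w.2

end Matched

/-! ### Counting the labelings of a cyclic pattern -/

section Fiber

variable {Γ : Type*} {n : ℕ}

/-- The cyclic word of type `f` with given labels. -/
def assemble (f : ZMod n → Shape) (φ : {c // f c ≠ .one} → Γ) (c : ZMod n) : Symbol Γ :=
  if h : f c ≠ .one then (f c).build (φ ⟨c, h⟩) else .one

theorem shape_assemble (f : ZMod n → Shape) (φ : {c // f c ≠ .one} → Γ) (c : ZMod n) :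
    (assemble f φ c).shape = f c := by
  unfold assemble
  split_ifs with h
  · exact Shape.shape_build _ _
  · simpa [Symbol.shape] using (not_not.1 h).symm

theorem assemble_injective (f : ZMod n → Shape) :
    Function.Injective (assemble f : ({c // f c ≠ .one} → Γ) → ZMod n → Symbol Γ) := by
  intro φ ψ h
  funext ⟨c, hc⟩
  have := congrFun h c
  rw [assemble, assemble, dif_pos hc, dif_pos hc] at this
  exact Shape.build_injective hc this

theorem assemble_label (d : Γ) (u : ZMod n → Symbol Γ) :
    assemble (fun c => (u c).shape) (fun c => (u c).label d) = u := by
  funext c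
  unfold assemble
  split_ifs with h
  · exact Symbol.build_shape_label d _
  · rcases hu : u c <;> simp_all [Symbol.shape]

theorem natCard_count [NeZero n] (f : ZMod n → Shape) (s : Shape) (hs : s ≠ .one) :
    Nat.card {w : {c // f c ≠ .one} // f w = s} = count f s := by
  rw [count, ← Fintype.card_subtype, ← Nat.card_eq_fintype_card]
  refine Nat.card_congr ⟨fun w => ⟨w.1.1, w.2⟩, fun c => ⟨⟨c.1, by rw [c.2]; exact hs⟩, c.2⟩,
    fun _ => rfl, fun _ => rfl⟩

theorem isHeight_unroll {f : ZMod n → Shape} {H : ℤ → ℤ}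
    (hH : ∀ k : ℤ, H (k + 1) = H k + (f k).step) {u : ZMod n → Symbol Γ}
    (hu : ∀ c, (u c).shape = f c) : IsHeight (unroll u) H := fun k => by
  rw [hH, ← hu, Symbol.step_shape]
  rfl

theorem Matched.shape_left {f : ZMod n → Shape} {H : ℤ → ℤ}
    (hH : ∀ k : ℤ, H (k + 1) = H k + (f k).step) {i j : ℤ} (h : Matched H i j) :
    f i = .minus := by
  have h1 := h.2.2 (i + 1) (by omega) (by have := h.1; omega)
  rw [hH] at h1
  rcases hf : f i <;> simp [hf, Shape.step] at h1 ⊢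

theorem Matched.shape_right {f : ZMod n → Shape} {H : ℤ → ℤ}
    (hH : ∀ k : ℤ, H (k + 1) = H k + (f k).step) {i j : ℤ} (h : Matched H i j) :
    f j = .plus := by
  have h1 := h.2.2 j h.1 le_rfl
  have h2 := h.2.1
  rw [hH] at h2
  rcases hf : f j <;> simp [hf, Shape.step] at h2 ⊢ <;> omega

theorem compatible_assemble_iff {f : ZMod n → Shape} {H : ℤ → ℤ}
    (hH : ∀ k : ℤ, H (k + 1) = H k + (f k).step) (φ : {c // f c ≠ .one} → Γ) :
    Compatible (unroll (assemble f φ)) H ↔ ∀ w w' : {c // f c ≠ .one},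
      (∃ i j : ℤ, (i : ZMod n) = w ∧ (j : ZMod n) = w' ∧ Matched H i j) → φ w = φ w' := by
  constructor
  · rintro hc ⟨_, hi⟩ ⟨_, hj⟩ ⟨i, j, rfl, rfl, hm⟩
    refine hc i j _ _ hm.1 ?_ ?_ hm.2.1 hm.2.2
    · simp [unroll, assemble, hm.shape_left hH, Shape.build]
    · simp [unroll, assemble, hm.shape_right hH, Shape.build]
  · intro h i j γ δ hij hxi hxj hH' hk
    have hm : Matched H i j := ⟨hij, hH', hk⟩
    have h1 := hm.shape_left hH
    have h2 := hm.shape_right hH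
    have := h ⟨i, by simp [h1]⟩ ⟨j, by simp [h2]⟩ ⟨i, j, rfl, rfl, hm⟩
    simp only [unroll, assemble, h1, h2, Shape.build] at hxi hxj
    simp at hxi hxj
    rw [← hxi, ← hxj, this]

/-- With nonnegative drift, the height one period before `j + 1` is at most `H (j + 1)`, so the path
must have risen through that level within the last period. -/
theorem exists_matched_left [NeZero n] {f : ZMod n → Shape} {H : ℤ → ℤ} {d : ℤ}
    (hH : ∀ k : ℤ, H (k + 1) = H k + (f k).step) (hp : ∀ k t, H (k + t * n) = H k + t * d)
    (hd : 0 ≤ d) {j : ℤ} (hj : f j = .plus) : ∃ i, Matched H i j := by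
  have hn : (0 : ℤ) < n := by exact_mod_cast NeZero.pos n
  have h1 := hH j
  have h2 := hp (j + 1) (-1)
  simp only [hj, Shape.step] at h1
  have hu : IsHeight (unroll fun c => (f c).build ()) H :=
    isHeight_unroll hH fun c => Shape.shape_build _ _
  obtain ⟨i, -, hij, hi, -, hk⟩ := hu.exists_upcrossing (a := j + 1 + -1 * n) (b := j)
    (l := H (j + 1)) (by omega) (by omega) (by omega)
  exact ⟨i, hij, hi.symm, fun k hk1 hk2 => hi ▸ hk k hk1 hk2⟩

theorem exists_matched_right [NeZero n] {f : ZMod n → Shape} {H : ℤ → ℤ} {d : ℤ}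
    (hH : ∀ k : ℤ, H (k + 1) = H k + (f k).step) (hp : ∀ k t, H (k + t * n) = H k + t * d)
    (hd : d ≤ 0) {i : ℤ} (hi : f i = .minus) : ∃ j, Matched H i j := by
  have hn : (0 : ℤ) < n := by exact_mod_cast NeZero.pos n
  have h1 := hH i
  have h2 := hp i 1
  simp only [hi, Shape.step] at h1
  have hu : IsHeight (unroll fun c => (f c).build ()) H :=
    isHeight_unroll hH fun c => Shape.shape_build _ _
  obtain ⟨j, hij, -, -, hj, hk⟩ := hu.exists_downcrossing (a := i + 1) (b := i + 1 * n)
    (l := H i) (by omega) (by omega) (by omega)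
  exact ⟨j, by omega, hj, fun k hk1 hk2 => hk k (by omega) hk2⟩

theorem exists_translate_of_intCast_eq {i j : ℤ} (h : (i : ZMod n) = j) :
    ∃ t : ℤ, j = i + t * n := by
  rw [ZMod.intCast_eq_intCast_iff_dvd_sub] at h
  obtain ⟨t, ht⟩ := h
  exact ⟨t, by linarith [mul_comm t (n : ℤ)]⟩

/-- The sign of the drift decides which kind of bracket is always matched; translating matched pairs
by whole periods makes the partner unique modulo `n`. -/
theorem natCard_compatible [NeZero n] [Finite Γ] {f : ZMod n → Shape} {H : ℤ → ℤ}
    (hH : ∀ k : ℤ, H (k + 1) = H k + (f k).step)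
    (hp : ∀ k t, H (k + t * n) = H k + t * ((count f .minus : ℤ) - count f .plus)) :
    Nat.card {φ : {c // f c ≠ .one} → Γ // Compatible (unroll (assemble f φ)) H} =
      Nat.card Γ ^ max (count f .minus) (count f .plus) := by
  simp_rw [compatible_assemble_iff hH]
  rcases le_total (count f .plus) (count f .minus) with hle | hle
  · rw [max_eq_left hle, ← natCard_count f .minus (by simp),
      ← natCard_labelings (Γ := Γ) (fun w : {c // f c ≠ .one} => f w = .minus)
        (fun w' w => ∃ i j : ℤ, (i : ZMod n) = w ∧ (j : ZMod n) = w' ∧ Matched H i j)]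
    · refine Nat.card_congr (Equiv.subtypeEquivRight fun φ => ?_)
      exact ⟨fun h w' w hw => (h w w' hw).symm, fun h w w' hw => (h w' w hw).symm⟩
    · rintro ⟨_, hj⟩ ⟨_, hi⟩ ⟨i, j, rfl, rfl, hm⟩
      exact ⟨by simp [hm.shape_right hH], hm.shape_left hH⟩
    · rintro ⟨c, hc⟩ hcm
      obtain ⟨j, rfl⟩ := ZMod.intCast_surjective c
      obtain ⟨i, hm⟩ := exists_matched_left hH hp (by omega) (j := j)
        (by rcases hf : f j <;> simp_all)
      exact ⟨⟨i, by simp [hm.shape_left hH]⟩, i, j, rfl, rfl, hm⟩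
    · rintro ⟨c, hc⟩ ⟨_, h1⟩ ⟨_, h2⟩ ⟨i, j, rfl, hj, hm⟩ ⟨i', j', rfl, hj', hm'⟩
      obtain ⟨t, rfl⟩ := exists_translate_of_intCast_eq (hj.trans hj'.symm)
      have := (hm.translate hp t).eq_left hm'
      simp [← this]
  · rw [max_eq_right hle, ← natCard_count f .plus (by simp),
      ← natCard_labelings (Γ := Γ) (fun w : {c // f c ≠ .one} => f w = .plus)
        (fun w w' => ∃ i j : ℤ, (i : ZMod n) = w ∧ (j : ZMod n) = w' ∧ Matched H i j)]
    · rintro ⟨_, hj⟩ ⟨_, hi⟩ ⟨i, j, rfl, rfl, hm⟩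
      exact ⟨by simp [hm.shape_left hH], hm.shape_right hH⟩
    · rintro ⟨c, hc⟩ hcm
      obtain ⟨i, rfl⟩ := ZMod.intCast_surjective c
      obtain ⟨j, hm⟩ := exists_matched_right hH hp (by omega) (i := i)
        (by rcases hf : f i <;> simp_all)
      exact ⟨⟨j, by simp [hm.shape_right hH]⟩, i, j, rfl, rfl, hm⟩
    · rintro ⟨c, hc⟩ ⟨_, h1⟩ ⟨_, h2⟩ ⟨i, j, hi, rfl, hm⟩ ⟨i', j', hi', rfl, hm'⟩
      obtain ⟨t, rfl⟩ := exists_translate_of_intCast_eq (hi.trans hi'.symm)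
      have := (hm.translate hp t).eq_right hm'
      simp [← this]

theorem ncard_motzkinShift_of_shape [NeZero n] [Finite Γ] [Nonempty Γ] (f : ZMod n → Shape) :
    {u : ZMod n → Symbol Γ | (fun c => (u c).shape) = f ∧
      unroll u ∈ (motzkinShift Γ).carrier}.ncard =
      Nat.card Γ ^ max (count f .minus) (count f .plus) := by
  obtain ⟨H, hH, hp⟩ := exists_height f
  rw [← natCard_compatible hH hp]
  change _ = {φ | Compatible (unroll (assemble f φ)) H}.ncard
  rw [← Set.ncard_image_of_injective _ (assemble_injective (Γ := Γ) f)]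
  congr 1
  ext u
  constructor
  · rintro ⟨rfl, hu⟩
    obtain ⟨d⟩ := ‹Nonempty Γ›
    refine ⟨fun c => (u c).label d, ?_, assemble_label d u⟩
    change Compatible _ _
    rw [assemble_label d u]
    exact compatible_of_mem_motzkinShift (isHeight_unroll hH fun _ => rfl) hu
  · rintro ⟨φ, hφ, rfl⟩
    exact ⟨funext (shape_assemble f φ), Compatible.mem_motzkinShift
      (isHeight_unroll hH (shape_assemble f φ)) hφ⟩

end Fiber

/-! ### The excluded words as a condition on types -/

section Admissible

variable {Γ : Type*} {n : ℕ}

/-- The condition on a cyclic word of types that expresses that no excluded word appears. -/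
def Admissible (f : ZMod n → Shape) : Prop :=
  ∀ c, (f c = .plus → f (c + 1) = .one) ∧
    (f (c + 1) = .one → f (c + 1 + 1) = .plus → f c = .plus)

theorem factor_two {A : Type*} (x : ℤ → A) (i : ℤ) : factor x i 2 = [x i, x (i + 1)] := by
  rw [factor_succ, factor_succ]
  simp [factor]

theorem factor_three {A : Type*} (x : ℤ → A) (i : ℤ) :
    factor x i 3 = [x i, x (i + 1), x (i + 1 + 1)] := by
  rw [factor_succ, factor_two]

/-- The word γ(-) 1 δ(+) with δ ≠ γ is not excluded but has product zero; membership in the Motzkin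
shift rules it out, and so the labels drop out of the condition. -/
theorem unroll_avoids_iff {u : ZMod n → Symbol Γ} (hu : unroll u ∈ (motzkinShift Γ).carrier) :
    (∀ (i : ℤ) (m : ℕ), factor (unroll u) i m ∉ excludedWords Γ) ↔
      Admissible fun c => (u c).shape := by
  have hlen : ∀ (i : ℤ) (m : ℕ), (factor (unroll u) i m).length = m := by simp [factor]
  constructor
  · intro h c
    obtain ⟨i, rfl⟩ := ZMod.intCast_surjective c
    have h2 := h i 2
    have h3 := h i 3
    have h5 : ((factor (unroll u) i 3).map Symbol.value).prod ≠ 0 := hu i 3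
    rw [factor_two] at h2
    rw [factor_three] at h3 h5
    simp only [excludedWords, Set.mem_ofPred_eq, unroll] at h2 h3 h5
    push_cast at h2 h3 h5
    rcases h0 : u i <;> rcases h1 : u (i + 1) <;> rcases h4 : u (i + 1 + 1) <;>
      simp [h0, h1, h4, Symbol.shape] at h2 h3 ⊢
    simp only [h0, h1, h4, List.map_cons, List.map_nil, List.prod_cons, List.prod_nil, mul_one] at h5
    rw [show (Symbol.one : Symbol Γ).value = 1 from rfl, one_mul,
      Symbol.value_minus_mul_plus_diff fun e => h3 e.symm] at h5
    exact h5 rfl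
  · intro h i m hm
    have hl := hlen i m
    have h1 := h i
    rcases hm with ⟨γ, δ, e⟩ | ⟨γ, δ, e⟩ | ⟨γ, e⟩ | ⟨γ, e⟩ <;> rw [e] at hl <;>
      simp only [List.length_cons, List.length_nil] at hl <;> subst hl
    · rw [factor_two] at e
      simp only [unroll, List.cons.injEq] at e
      push_cast at e
      simp [e.1, e.2.1, Symbol.shape] at h1
    · rw [factor_two] at e
      simp only [unroll, List.cons.injEq] at e
      push_cast at e
      simp [e.1, e.2.1, Symbol.shape] at h1
    · rw [factor_three] at e
      simp only [unroll, List.cons.injEq] at e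
      push_cast at e
      simp [e.1, e.2.1, e.2.2.1, Symbol.shape] at h1
    · rw [factor_three] at e
      simp only [unroll, List.cons.injEq] at e
      push_cast at e
      simp [e.1, e.2.1, e.2.2.1, Symbol.shape] at h1

open Classical in
theorem ncard_periodicPoints_shiftX [NeZero n] [Finite Γ] [Nonempty Γ] :
    (periodicPoints (shiftX Γ).carrier n).ncard =
      ∑ f ∈ Finset.univ.filter (Admissible (n := n)),
        Nat.card Γ ^ max (count f .minus) (count f .plus) := by
  have := Fintype.ofFinite (Symbol Γ)
  rw [ncard_periodicPoints, Set.ncard_eq_toFinset_card',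
    Finset.card_eq_sum_card_fiberwise (f := fun u c => (u c).shape)
      (t := Finset.univ.filter (Admissible (n := n)))]
  · refine Finset.sum_congr rfl fun f hf => ?_
    rw [← ncard_motzkinShift_of_shape f, Set.ncard_eq_toFinset_card']
    congr 1
    ext u
    simp only [Finset.mem_filter, Finset.mem_univ, true_and, Set.mem_toFinset,
      Set.mem_ofPred_eq] at hf ⊢
    constructor
    · rintro ⟨hu, rfl⟩
      exact ⟨rfl, hu.1⟩
    · rintro ⟨rfl, hu⟩
      exact ⟨⟨hu, (unroll_avoids_iff hu).2 hf⟩, rfl⟩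
  · intro u hu
    simp only [Finset.coe_filter, Finset.mem_univ, true_and, Set.mem_ofPred_eq]
    simp only [Set.coe_toFinset, Set.mem_ofPred_eq] at hu
    exact (unroll_avoids_iff hu.1).1 hu.2

theorem ncard_periodicPoints_le {Γ : Type*} [Finite Γ] (Y : Set (ℤ → Symbol Γ)) (n : ℕ)
    [NeZero n] : (periodicPoints Y n).ncard ≤ (2 * Nat.card Γ + 1) ^ n := by
  rw [ncard_periodicPoints]
  refine (Set.ncard_le_card _).trans_eq ?_
  rw [Nat.card_fun, Symbol.natCard, Nat.card_zmod]

end Admissible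

/-! ### Traces of matrix powers as sums over closed walks -/

section ClosedWalks

variable {ι R : Type*} [Fintype ι] [DecidableEq ι] [CommRing R]

theorem pow_succ_apply_eq_sum_walks (A : Matrix ι ι R) (m : ℕ) (i j : ι) :
    (A ^ (m + 1)) i j = ∑ g : Fin m → ι,
      ∏ k : Fin (m + 1), A (Fin.cons (α := fun _ => ι) i g k) (Fin.snoc (α := fun _ => ι) g j k) := by
  induction m generalizing i with
  | zero => simp [Fin.snoc]
  | succ m ih =>
    rw [pow_succ', Matrix.mul_apply, ← (Fin.consEquiv fun _ : Fin (m + 1) => ι).sum_comp,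
      Fintype.sum_prod_type]
    refine Finset.sum_congr rfl fun l _ => ?_
    rw [ih, Finset.mul_sum]
    refine Finset.sum_congr rfl fun g _ => ?_
    rw [Fin.prod_univ_succ (n := m + 1)]
    simp only [Fin.consEquiv, Equiv.coe_fn_mk, ← Fin.cons_snoc_eq_snoc_cons, Fin.cons_zero,
      Fin.cons_succ]

theorem trace_pow_eq_sum_closed_walks (A : Matrix ι ι R) (n : ℕ) [NeZero n] :
    (A ^ n).trace = ∑ g : ZMod n → ι, ∏ c, A (g c) (g (c + 1)) := by
  obtain ⟨m, rfl⟩ := Nat.exists_eq_succ_of_ne_zero (NeZero.ne n)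
  -- `ZMod (m + 1)` is `Fin (m + 1)` by definition, with the same cyclic addition.
  change _ = ∑ g : Fin (m + 1) → ι, ∏ c : Fin (m + 1), A (g c) (g (c + 1))
  rw [Matrix.trace, ← (Fin.consEquiv fun _ : Fin (m + 1) => ι).sum_comp, Fintype.sum_prod_type]
  refine Finset.sum_congr rfl fun i _ => ?_
  rw [Matrix.diag_apply, pow_succ_apply_eq_sum_walks]
  refine Finset.sum_congr rfl fun g _ => Finset.prod_congr rfl fun k _ => ?_
  congr 1
  induction k using Fin.lastCases with
  | last => simp [Fin.consEquiv]
  | cast k => simp [Fin.consEquiv, Fin.coeSucc_eq_succ]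

end ClosedWalks

/-! ### The transfer matrix -/

section Transfer

/-- The type of symbol that belongs to a state. The states are: after `γ(-)`, after `γ(+)`,
after a `1` that follows some `γ(+)`, after any other `1`. -/
def stateShape : Fin 4 → Shape := ![.minus, .plus, .one, .one]

/-- The state after two given consecutive symbol types. -/
def stateOf : Shape → Shape → Fin 4
  | _, .minus => 0
  | _, .plus => 1
  | .plus, .one => 2
  | _, .one => 3

/-- The transitions between states. -/
def Transition (s s' : Fin 4) : Prop :=
  (s, s') ∈ [(0, 0), (0, 1), (0, 3), (1, 2), (2, 0), (2, 1), (2, 3), (3, 0), (3, 3)]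

instance : DecidableRel Transition := fun s s' => by unfold Transition; infer_instance

theorem Transition.stateOf_eq : ∀ a b : Fin 4, Transition a b →
    stateOf (stateShape a) (stateShape b) = b := by decide

theorem Transition.admissible : ∀ a b d : Fin 4, Transition a b → Transition b d →
    (stateShape a = .plus → stateShape b = .one) ∧
      (stateShape b = .one → stateShape d = .plus → stateShape a = .plus) := by decide

theorem stateShape_stateOf : ∀ p q : Shape, stateShape (stateOf p q) = q := by decide

theorem transition_stateOf : ∀ p q r : Shape, (p = .plus → q = .one) →
    (q = .one → r = .plus → p = .plus) → (q = .plus → r = .one) →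
    Transition (stateOf p q) (stateOf q r) := by decide

variable {n : ℕ} [NeZero n]

-- The state at `c` is determined by the types at `c - 1` and `c`, so admissible cyclic words
-- correspond bijectively to closed walks of states.
open Classical in
theorem sum_admissible_eq_sum_walks {R : Type*} [CommRing R] (w : Shape → R) :
    ∑ f ∈ Finset.univ.filter (Admissible (n := n)), ∏ c, w (f c) =
      ∑ g : ZMod n → Fin 4, ∏ c, if Transition (g c) (g (c + 1)) then w (stateShape (g (c + 1)))
        else 0 := by
  have h1 : ∀ g : ZMod n → Fin 4,
      (∏ c, if Transition (g c) (g (c + 1)) then w (stateShape (g (c + 1))) else 0) =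
        if ∀ c, Transition (g c) (g (c + 1)) then ∏ c, w (stateShape (g c)) else 0 := by
    intro g
    rw [Finset.prod_ite_zero]
    simp only [Finset.mem_univ, true_implies]
    rw [← Equiv.prod_comp (Equiv.addRight (1 : ZMod n)) fun c => w (stateShape (g c))]
    rfl
  simp_rw [h1]
  rw [← Finset.sum_filter]
  refine Finset.sum_nbij' (fun f c => stateOf (f (c - 1)) (f c)) (fun g c => stateShape (g c))
    ?_ ?_ ?_ ?_ ?_
  · intro f hf
    simp only [Finset.mem_filter, Finset.mem_univ, true_and] at hf ⊢
    intro c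
    have h2 := hf (c - 1)
    have h3 := hf c
    rw [sub_add_cancel] at h2
    rw [add_sub_cancel_right]
    exact transition_stateOf _ _ _ h2.1 h2.2 h3.1
  · intro g hg
    simp only [Finset.mem_filter, Finset.mem_univ, true_and] at hg ⊢
    exact fun c => Transition.admissible _ _ _ (hg c) (hg (c + 1))
  · intro f _
    funext c
    exact stateShape_stateOf _ _
  · intro g hg
    simp only [Finset.mem_filter, Finset.mem_univ, true_and] at hg
    funext c
    have := hg (c - 1)
    rw [sub_add_cancel] at this
    exact Transition.stateOf_eq _ _ this
  · intro f _
    simp only [stateShape_stateOf]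

variable {R : Type*} [CommRing R]

/-- The transfer matrix with weights `α` for `γ(-)` and `β` for `γ(+)`. -/
def transfer (α β : R) : Matrix (Fin 4) (Fin 4) R :=
  !![α, β, 0, 1; 0, 0, 1, 0; α, β, 0, 1; α, 0, 0, 1]

/-- The weight of a symbol type. -/
def Shape.weight (α β : R) : Shape → R
  | .minus => α
  | .plus => β
  | .one => 1

theorem transfer_apply (α β : R) (s s' : Fin 4) :
    transfer α β s s' = if Transition s s' then (stateShape s').weight α β else 0 := by
  fin_cases s <;> fin_cases s' <;> simp [transfer, Transition, stateShape, Shape.weight]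

theorem prod_weight (α β : R) (f : ZMod n → Shape) :
    ∏ c, (f c).weight α β = α ^ count f .minus * β ^ count f .plus := by
  have h : ∀ s : Shape, s.weight α β =
      (if s = .minus then α else 1) * (if s = .plus then β else 1) := by
    rintro (_ | _ | _) <;> simp [Shape.weight]
  simp_rw [h, Finset.prod_mul_distrib, ← Finset.prod_filter, Finset.prod_const]
  rfl

open Classical in
theorem sum_admissible_eq_trace (α β : R) :
    ∑ f ∈ Finset.univ.filter (Admissible (n := n)), α ^ count f .minus * β ^ count f .plus =
      (transfer α β ^ n).trace := by
  rw [trace_pow_eq_sum_closed_walks]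
  simp_rw [transfer_apply, ← prod_weight]
  exact sum_admissible_eq_sum_walks _

theorem transfer_sq (α β : R) : transfer α β ^ 2 =
    !![α ^ 2 + α, α * β, β, α + 1; α, β, 0, 1; α ^ 2 + α, α * β, β, α + 1;
      α ^ 2 + α, α * β, 0, α + 1] := by
  rw [sq]
  ext i j
  fin_cases i <;> fin_cases j <;> simp [transfer, Matrix.mul_apply, Fin.sum_univ_four] <;> ring

theorem transfer_pow_three (α β : R) : transfer α β ^ 3 =
    !![α ^ 3 + 2 * α ^ 2 + α + α * β, α ^ 2 * β + α * β + β ^ 2, α * β, α ^ 2 + 2 * α + 1 + β;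
      α ^ 2 + α, α * β, β, α + 1;
      α ^ 3 + 2 * α ^ 2 + α + α * β, α ^ 2 * β + α * β + β ^ 2, α * β, α ^ 2 + 2 * α + 1 + β;
      α ^ 3 + 2 * α ^ 2 + α, α ^ 2 * β + α * β, α * β, α ^ 2 + 2 * α + 1] := by
  rw [pow_succ, transfer_sq]
  ext i j
  fin_cases i <;> fin_cases j <;> simp [transfer, Matrix.mul_apply, Fin.sum_univ_four] <;> ring

/-- This is Cayley–Hamilton. The constant term vanishes because two rows of the matrix coincide, so
three coefficients suffice in the trace recursion. -/
theorem transfer_pow_four (α β : R) : transfer α β ^ 4 =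
    (1 + α) • transfer α β ^ 3 + β • transfer α β ^ 2 - β • transfer α β := by
  rw [pow_succ, transfer_pow_three, transfer_sq]
  ext i j
  fin_cases i <;> fin_cases j <;> simp [transfer, Matrix.mul_apply, Fin.sum_univ_four] <;> ring

theorem trace_transfer (α β : R) : (transfer α β).trace = 1 + α := by
  simp [Matrix.trace, transfer, Fin.sum_univ_four]
  ring

theorem trace_transfer_sq (α β : R) :
    (transfer α β ^ 2).trace = (1 + α) * (1 + α) + 2 * β := by
  rw [transfer_sq]
  simp [Matrix.trace, Fin.sum_univ_four]
  ring

theorem trace_transfer_pow_three (α β : R) : (transfer α β ^ 3).trace =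
    (1 + α) * ((1 + α) * (1 + α) + 2 * β) + β * (1 + α) - 3 * β := by
  rw [transfer_pow_three]
  simp [Matrix.trace, Fin.sum_univ_four]
  ring

theorem trace_transfer_pow_add_four (α β : R) (n : ℕ) : (transfer α β ^ (n + 4)).trace =
    (1 + α) * (transfer α β ^ (n + 3)).trace + β * (transfer α β ^ (n + 2)).trace -
      β * (transfer α β ^ (n + 1)).trace := by
  rw [pow_add, transfer_pow_four]
  simp only [mul_add, mul_sub, Matrix.mul_smul, Matrix.trace_add, Matrix.trace_sub,
    Matrix.trace_smul, smul_eq_mul, pow_add, pow_one]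

end Transfer

/-! ### From power sums to the determinant -/

section LogDet

/-- The hypotheses are Newton's identities. They say that the exponent has derivative -Q'/Q, where Q
is the cubic factor, so the product has derivative zero and keeps its value 1 at the origin. -/
theorem exp_tsum_mul_eq_one_of_norm_lt_one {T : ℕ → ℂ} {e₁ e₂ e₃ : ℂ} (h0 : T 0 = e₁)
    (h1 : T 1 = e₁ * T 0 + 2 * e₂) (h2 : T 2 = e₁ * T 1 + e₂ * T 0 + 3 * e₃)
    (h3 : ∀ n, T (n + 3) = e₁ * T (n + 2) + e₂ * T (n + 1) + e₃ * T n)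
    (hs : Summable fun n : ℕ => ‖T n / ((n + 1 : ℕ) : ℂ)‖) {w : ℂ} (hw : ‖w‖ < 1) :
    Complex.exp (∑' n : ℕ, T n / ((n + 1 : ℕ) : ℂ) * w ^ (n + 1)) *
      (1 - e₁ * w - e₂ * w ^ 2 - e₃ * w ^ 3) = 1 := by
  set B := ∑' n : ℕ, ‖T n / ((n + 1 : ℕ) : ℂ)‖
  have hB : ∀ n, ‖T n‖ ≤ B * (n + 1) := fun n => by
    have := hs.le_tsum n fun _ _ => norm_nonneg _
    rw [norm_div, Complex.norm_natCast, div_le_iff₀ (by positivity)] at this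
    exact_mod_cast this
  obtain ⟨ρ, hwρ, hρ⟩ := exists_between hw
  have hρ0 : 0 ≤ ρ := (norm_nonneg w).trans hwρ.le
  have hu : Summable fun n : ℕ => B * (n + 1) * ρ ^ n := by
    have e1 := summable_pow_mul_geometric_of_norm_lt_one (R := ℝ) 1
      (by rwa [Real.norm_of_nonneg hρ0] : ‖ρ‖ < 1)
    have e2 := summable_geometric_of_lt_one hρ0 hρ
    refine ((e1.add e2).mul_left B).congr fun n => ?_
    ring
  have hbound : ∀ n : ℕ, ∀ v ∈ Metric.ball (0 : ℂ) ρ, ‖T n * v ^ n‖ ≤ B * (n + 1) * ρ ^ n := by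
    intro n v hv
    rw [norm_mul, norm_pow]
    have : ‖v‖ ≤ ρ := (mem_ball_zero_iff.1 hv).le
    exact mul_le_mul (hB n) (by gcongr) (by positivity) ((norm_nonneg _).trans (hB n))
  have hder : ∀ v ∈ Metric.ball (0 : ℂ) ρ,
      HasDerivAt (fun v => ∑' n : ℕ, T n / ((n + 1 : ℕ) : ℂ) * v ^ (n + 1))
        (∑' n : ℕ, T n * v ^ n) v := by
    intro v hv
    refine hasDerivAt_tsum_of_isPreconnected hu Metric.isOpen_ball
      (convex_ball (0 : ℂ) ρ).isPreconnected (g := fun n v => T n / ((n + 1 : ℕ) : ℂ) * v ^ (n + 1))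
      (fun n v _ => ?_) hbound (y₀ := 0) (Metric.mem_ball_self ((norm_nonneg w).trans_lt hwρ)) ?_ hv
    · refine ((hasDerivAt_pow (n + 1) v).const_mul (T n / ((n + 1 : ℕ) : ℂ))).congr_deriv ?_
      have : ((n + 1 : ℕ) : ℂ) ≠ 0 := Nat.cast_ne_zero.2 n.succ_ne_zero
      rw [← mul_assoc, div_mul_cancel₀ _ this, Nat.add_sub_cancel]
    · simp
  have hlog : ∀ v ∈ Metric.ball (0 : ℂ) ρ, (∑' n : ℕ, T n * v ^ n) *
      (1 - e₁ * v - e₂ * v ^ 2 - e₃ * v ^ 3) = e₁ + 2 * e₂ * v + 3 * e₃ * v ^ 2 := by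
    intro v hv
    have hS : Summable fun n : ℕ => T n * v ^ n := .of_norm_bounded hu fun n => hbound n v hv
    have s1 := hS.sum_add_tsum_nat_add 1
    have s2 := hS.sum_add_tsum_nat_add 2
    have s3 := hS.sum_add_tsum_nat_add 3
    have s4 : ∑' n : ℕ, T (n + 3) * v ^ (n + 3) = e₁ * v * ∑' n : ℕ, T (n + 2) * v ^ (n + 2) +
        e₂ * v ^ 2 * ∑' n : ℕ, T (n + 1) * v ^ (n + 1) +
          e₃ * v ^ 3 * ∑' n : ℕ, T n * v ^ n := by
      have a1 := ((summable_nat_add_iff 1).2 hS).hasSum.mul_left (e₂ * v ^ 2)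
      have a2 := ((summable_nat_add_iff 2).2 hS).hasSum.mul_left (e₁ * v)
      have a0 := hS.hasSum.mul_left (e₃ * v ^ 3)
      rw [← ((a2.add a1).add a0).tsum_eq]
      refine tsum_congr fun n => ?_
      rw [h3]
      ring
    simp only [Finset.sum_range_succ, Finset.sum_range_zero] at s1 s2 s3
    rw [h0] at s1 s2 s3 h1 h2
    rw [h1] at s2 s3 h2
    rw [h2] at s3
    linear_combination -s3 + s4 + e₁ * v * s2 + e₂ * v ^ 2 * s1
  have hconst : ∀ v ∈ Metric.ball (0 : ℂ) ρ, HasDerivAt (fun v =>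
      Complex.exp (∑' n : ℕ, T n / ((n + 1 : ℕ) : ℂ) * v ^ (n + 1)) *
        (1 - e₁ * v - e₂ * v ^ 2 - e₃ * v ^ 3)) 0 v := by
    intro v hv
    have d1 := (hder v hv).cexp
    have d2 : HasDerivAt (fun v : ℂ => 1 - e₁ * v - e₂ * v ^ 2 - e₃ * v ^ 3)
        (-e₁ - e₂ * (2 * v) - e₃ * (3 * v ^ 2)) v := by
      refine ((((hasDerivAt_const v (1 : ℂ)).sub ((hasDerivAt_id v).const_mul e₁)).sub
        ((hasDerivAt_pow 2 v).const_mul e₂)).sub ((hasDerivAt_pow 3 v).const_mul e₃)).congr_deriv ?_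
      norm_num
    refine (d1.mul d2).congr_deriv ?_
    linear_combination Complex.exp (∑' n : ℕ, T n / ((n + 1 : ℕ) : ℂ) * v ^ (n + 1)) * hlog v hv
  have key := Metric.isOpen_ball.is_const_of_deriv_eq_zero (convex_ball (0 : ℂ) ρ).isPreconnected
    (fun v hv => (hconst v hv).differentiableAt.differentiableWithinAt)
    (fun v hv => (hconst v hv).deriv) (mem_ball_zero_iff.2 hwρ)
    (Metric.mem_ball_self ((norm_nonneg w).trans_lt hwρ))
  simpa using key

/-- The point 1 may lie on the boundary of the disc of convergence; absolute convergence there gives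
continuity on the closed disc, and the identity extends from the interior. -/
theorem exp_tsum_mul_eq_one {T : ℕ → ℂ} {e₁ e₂ e₃ : ℂ} (h0 : T 0 = e₁)
    (h1 : T 1 = e₁ * T 0 + 2 * e₂) (h2 : T 2 = e₁ * T 1 + e₂ * T 0 + 3 * e₃)
    (h3 : ∀ n, T (n + 3) = e₁ * T (n + 2) + e₂ * T (n + 1) + e₃ * T n)
    (hs : Summable fun n : ℕ => ‖T n / ((n + 1 : ℕ) : ℂ)‖) :
    Complex.exp (∑' n : ℕ, T n / ((n + 1 : ℕ) : ℂ)) * (1 - e₁ - e₂ - e₃) = 1 := by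
  have hc : ContinuousOn (fun v : ℂ =>
      Complex.exp (∑' n : ℕ, T n / ((n + 1 : ℕ) : ℂ) * v ^ (n + 1)) *
        (1 - e₁ * v - e₂ * v ^ 2 - e₃ * v ^ 3)) (Metric.closedBall 0 1) := by
    refine ContinuousOn.mul (ContinuousOn.cexp (continuousOn_tsum (fun n => by fun_prop) hs ?_))
      (by fun_prop)
    intro n v hv
    rw [norm_mul, norm_pow]
    exact mul_le_of_le_one_right (norm_nonneg _)
      (pow_le_one₀ (norm_nonneg _) (mem_closedBall_zero_iff.1 hv))
  have heq := Set.EqOn.of_subset_closure (s := Metric.ball (0 : ℂ) 1) (g := fun _ => (1 : ℂ))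
    (fun v hv => exp_tsum_mul_eq_one_of_norm_lt_one h0 h1 h2 h3 hs (mem_ball_zero_iff.1 hv))
    hc continuousOn_const Metric.ball_subset_closedBall
    (closure_ball (0 : ℂ) one_ne_zero).ge
  simpa using heq (x := 1) (by simp)

end LogDet

/-! ### Laurent series with equal exponentials on the unit circle -/

section Laurent

open MeasureTheory

theorem exp_intCast_mul_I (k : ℤ) (θ : ℝ) :
    Complex.exp (θ * Complex.I) ^ k = Complex.exp (k * θ * Complex.I) := by
  rw [← Complex.exp_int_mul, mul_assoc]

theorem integral_exp_intCast_mul_I (k : ℤ) :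
    ∫ θ in (0 : ℝ)..(2 * Real.pi), Complex.exp (k * θ * Complex.I) =
      if k = 0 then 2 * Real.pi else 0 := by
  split_ifs with hk
  · simp [hk]
  · have hc : (k : ℂ) * Complex.I ≠ 0 := mul_ne_zero (Int.cast_ne_zero.2 hk) Complex.I_ne_zero
    have := integral_exp_mul_complex (a := 0) (b := 2 * Real.pi) hc
    simp_rw [show ∀ θ : ℝ, (k : ℂ) * θ * Complex.I = k * Complex.I * θ from fun θ => by ring, this]
    have e : Complex.exp (k * Complex.I * ((2 * Real.pi : ℝ) : ℂ)) = 1 :=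
      Complex.exp_eq_one_iff.2 ⟨k, by push_cast; ring⟩
    rw [e]
    simp

theorem laurent_coeff_eq_integral {d : ℤ → ℂ} (hd : Summable fun k => ‖d k‖) (m : ℤ) :
    ∫ θ in (0 : ℝ)..(2 * Real.pi), (∑' k, d k * Complex.exp (θ * Complex.I) ^ k) *
      Complex.exp ((-m : ℤ) * θ * Complex.I) = 2 * Real.pi * d m := by
  have hcongr : ∀ (k : ℤ) (θ : ℝ), d k * Complex.exp (θ * Complex.I) ^ k *
      Complex.exp ((-m : ℤ) * θ * Complex.I) = d k * Complex.exp ((k - m : ℤ) * θ * Complex.I) := by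
    intro k θ
    rw [exp_intCast_mul_I, mul_assoc, ← Complex.exp_add]
    congr 2
    push_cast
    ring
  have h := intervalIntegral.tsum_intervalIntegral_eq_of_summable_norm (a := 0)
    (b := 2 * Real.pi) (f := fun k : ℤ => (⟨fun θ : ℝ => d k *
      Complex.exp ((k - m : ℤ) * θ * Complex.I), by fun_prop⟩ : C(ℝ, ℂ)))
    (hd.of_nonneg_of_le (fun k => norm_nonneg _) fun k => ?_)
  · simp_rw [← tsum_mul_right, hcongr]
    refine h.symm.trans ?_
    simp only [ContinuousMap.coe_mk, intervalIntegral.integral_const_mul,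
      integral_exp_intCast_mul_I, sub_eq_zero]
    rw [tsum_eq_single m fun k hk => by simp [hk]]
    simp [mul_comm]
  · refine (ContinuousMap.norm_le _ (norm_nonneg _)).2 fun θ => ?_
    have : ‖Complex.exp ((k - m : ℤ) * ((θ : ℝ) : ℂ) * Complex.I)‖ = 1 := by
      exact_mod_cast Complex.norm_exp_ofReal_mul_I ((k - m : ℤ) * (θ : ℝ))
    simp only [ContinuousMap.restrict_apply, ContinuousMap.coe_mk, norm_mul, this, mul_one, le_refl]

theorem eq_of_continuous_of_exp_eq_one {h : ℝ → ℂ} (hc : Continuous h)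
    (he : ∀ θ, Complex.exp (h θ) = 1) (θ θ' : ℝ) : h θ = h θ' := by
  choose m hm using fun θ => Complex.exp_eq_one_iff.1 (he θ)
  have hcast : (fun θ => (m θ : ℝ)) = fun θ => (h θ / (2 * Real.pi * Complex.I)).re := by
    funext θ
    rw [hm, mul_div_cancel_right₀ _ Complex.two_pi_I_ne_zero, Complex.intCast_re]
  have hmc : Continuous m := by
    rw [Int.isClosedEmbedding_coe_real.isEmbedding.continuous_iff]
    change Continuous fun θ => (m θ : ℝ)
    rw [hcast]
    fun_prop
  rw [hm, hm θ', PreconnectedSpace.constant inferInstance hmc (x := θ) (y := θ')]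

/-- On the circle the series is continuous with values in 2πiℤ, hence constant; its Fourier
coefficients other than the constant one vanish, and that one is known only modulo 2πi. -/
theorem laurent_eq_zero_of_exp_eq_one {d : ℤ → ℂ} (hd : Summable fun k => ‖d k‖)
    (he : ∀ y : ℂ, ‖y‖ = 1 → Complex.exp (∑' k, d k * y ^ k) = 1) :
    (∀ k, k ≠ 0 → d k = 0) ∧ Complex.exp (d 0) = 1 := by
  have hc : Continuous fun θ : ℝ => ∑' k, d k * Complex.exp (θ * Complex.I) ^ k := by
    refine continuous_tsum (fun k => ?_) hd fun k θ => ?_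
    · simp_rw [exp_intCast_mul_I]
      fun_prop
    · rw [norm_mul, norm_zpow, Complex.norm_exp_ofReal_mul_I, one_zpow, mul_one]
  have hconst := eq_of_continuous_of_exp_eq_one hc
    fun θ => he _ (Complex.norm_exp_ofReal_mul_I θ)
  have hzero : ∀ k, k ≠ 0 → d k = 0 := by
    intro k hk
    have h := laurent_coeff_eq_integral hd k
    simp_rw [fun θ => hconst θ 0] at h
    rw [intervalIntegral.integral_const_mul, integral_exp_intCast_mul_I,
      if_neg (neg_ne_zero.2 hk), Complex.ofReal_zero, mul_zero] at h
    have hpi : (2 * Real.pi : ℂ) ≠ 0 := by simp [Real.pi_ne_zero]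
    exact (mul_eq_zero.1 h.symm).resolve_left hpi
  refine ⟨hzero, ?_⟩
  have := he 1 norm_one
  rwa [tsum_eq_single 0 fun k hk => by rw [hzero k hk, zero_mul], zpow_zero, mul_one] at this

theorem hasSum_fiber_mul {I : Type*} {τ : I → ℂ} {κ : I → ℤ} {V : ℤ → ℂ}
    (h : Summable fun i => τ i * V (κ i)) :
    HasSum (fun k => (∑' i : κ ⁻¹' {k}, τ i) * V k) (∑' i, τ i * V (κ i)) := by
  convert! h.hasSum.tsum_fiberwise κ using 2 with k
  rw [← tsum_mul_right]
  refine tsum_congr fun i => ?_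
  rw [i.2]

/-- If two absolutely convergent Laurent series have the same exponential on the unit circle, then
weighting their coefficients preserves the equality of exponentials. -/
theorem exp_weighted_eq {I : Type*} {τ : I → ℂ} {κ : I → ℤ} {M W : ℤ → ℂ}
    (hτ : Summable fun i => ‖τ i‖) (hM : Summable fun k => ‖M k‖) (hW0 : W 0 = 1)
    (hτW : Summable fun i => τ i * W (κ i)) (hMW : Summable fun k => M k * W k)
    (he : ∀ y : ℂ, ‖y‖ = 1 →
      Complex.exp (∑' i, τ i * y ^ κ i) = Complex.exp (∑' k, M k * y ^ k)) :
    Complex.exp (∑' i, τ i * W (κ i)) = Complex.exp (∑' k, M k * W k) := by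
  set L : ℤ → ℂ := fun k => ∑' i : κ ⁻¹' {k}, τ i
  have hsum : ∀ y : ℂ, ‖y‖ = 1 → HasSum (fun k => L k * y ^ k) (∑' i, τ i * y ^ κ i) := by
    intro y hy
    refine hasSum_fiber_mul (V := fun k => y ^ k) (Summable.of_norm (hτ.congr fun i => ?_))
    rw [norm_mul, norm_zpow, hy, one_zpow, mul_one]
  have hMsum : ∀ y : ℂ, ‖y‖ = 1 → Summable fun k => M k * y ^ k := by
    intro y hy
    refine Summable.of_norm (hM.congr fun i => ?_)
    rw [norm_mul, norm_zpow, hy, one_zpow, mul_one]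
  have hL : Summable L := by simpa using (hsum 1 norm_one).summable
  obtain ⟨h1, h2⟩ := laurent_eq_zero_of_exp_eq_one (d := fun k => L k - M k)
    (hL.sub hM.of_norm).norm fun y hy => by
      simp_rw [sub_mul]
      rw [((hsum y hy).summable).tsum_sub (hMsum y hy), Complex.exp_sub, (hsum y hy).tsum_eq,
        he y hy, div_self (Complex.exp_ne_zero _)]
  have hLW := hasSum_fiber_mul hτW
  have h3 : Complex.exp (∑' k, (L k * W k - M k * W k)) = 1 := by
    -- Only the constant coefficients can differ, by a multiple of 2πi, and `W 0 = 1` leaves that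
    -- difference unscaled.
    rw [tsum_eq_single 0 fun k hk => by rw [← sub_mul, h1 k hk, zero_mul], ← sub_mul, hW0, mul_one]
    exact h2
  rw [hLW.summable.tsum_sub hMW, hLW.tsum_eq, Complex.exp_sub,
    div_eq_one_iff_eq (Complex.exp_ne_zero _)] at h3
  exact h3

end Laurent

/-! ### The Laurent series of the logarithm of the factorized determinant -/

section LogSeries

/-- The coefficients of `-log (C (1 - p y) (1 - q / y))` as a Laurent series in `y`. -/
noncomputable def logCoeff (C p q : ℂ) : ℤ → ℂ
  | .ofNat 0 => -Complex.log C
  | .ofNat (n + 1) => p ^ (n + 1) / ((n + 1 : ℕ) : ℂ)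
  | .negSucc n => q ^ (n + 1) / ((n + 1 : ℕ) : ℂ)

theorem hasSum_pow_div_neg_log {p : ℂ} (hp : ‖p‖ < 1) :
    HasSum (fun n : ℕ => p ^ (n + 1) / ((n + 1 : ℕ) : ℂ)) (-Complex.log (1 - p)) := by
  have := (hasSum_nat_add_iff' 1).2 (Complex.hasSum_taylorSeries_neg_log hp)
  simpa using this

theorem hasSum_logCoeff (C : ℂ) {p q : ℂ} (hp : ‖p‖ < 1) (hq : ‖q‖ < 1) :
    HasSum (logCoeff C p q) (-Complex.log (1 - p) + -Complex.log C + -Complex.log (1 - q)) :=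
  HasSum.of_add_one_of_neg_add_one (f := logCoeff C p q) (hasSum_pow_div_neg_log hp)
    ((hasSum_pow_div_neg_log hq).congr_fun fun n => by
      rw [show (-((n : ℤ) + 1)) = Int.negSucc n by omega]
      rfl)

theorem exp_tsum_logCoeff {C p q : ℂ} (hC : C ≠ 0) (hp : ‖p‖ < 1) (hq : ‖q‖ < 1) :
    Complex.exp (∑' k, logCoeff C p q k) = (C * (1 - p) * (1 - q))⁻¹ := by
  have h : ∀ {p : ℂ}, ‖p‖ < 1 → 1 - p ≠ 0 := fun {p} hp h => by
    rw [← sub_eq_zero.1 h, norm_one] at hp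
    exact lt_irrefl _ hp
  rw [(hasSum_logCoeff C hp hq).tsum_eq, Complex.exp_add, Complex.exp_add, Complex.exp_neg,
    Complex.exp_neg, Complex.exp_neg, Complex.exp_log hC, Complex.exp_log (h hp),
    Complex.exp_log (h hq), mul_inv, mul_inv]
  ring

theorem logCoeff_mul_zpow (C p q : ℂ) (y : ℂ) (k : ℤ) :
    logCoeff C p q k * y ^ k = logCoeff C (p * y) (q * y⁻¹) k := by
  rcases k with (_ | n) | n
  · simp [logCoeff]
  · simp only [logCoeff, Int.ofNat_eq_natCast, zpow_natCast, mul_pow]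
    ring
  · simp only [logCoeff, zpow_negSucc, mul_pow, inv_pow]
    ring

/-- The weight touches only negative powers, whose coefficients are powers of `q` up to a
denominator, so it is absorbed into `q`. -/
theorem logCoeff_mul_pow_toNat (C p q b : ℂ) (k : ℤ) :
    logCoeff C p q k * b ^ (-k).toNat = logCoeff C p (q * b) k := by
  rcases k with (_ | n) | n
  · simp [logCoeff]
  · simp only [logCoeff, Int.ofNat_eq_natCast]
    rw [Int.toNat_of_nonpos (by omega), pow_zero, mul_one]
  · rw [show (-Int.negSucc n).toNat = n + 1 by omega]
    simp only [logCoeff, mul_pow]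
    ring

end LogSeries

/-! ### Bounds for the principal root -/

section Root

theorem sqrt_sq (a : ℂ) : Complex.sqrt a ^ 2 = a := by
  simp [Complex.sqrt]

theorem sqrt_re_nonneg (a : ℂ) : 0 ≤ (Complex.sqrt a).re := by
  rw [Complex.sqrt, Complex.cpow_inv_two_re]
  exact Real.sqrt_nonneg _

/-- The square of the real part is the mean of |σ|² and Re(σ²), and both are at least the bound. -/
theorem one_sub_le_re_sq {σ w : ℂ} (h : σ ^ 2 = 1 - 4 * w) : 1 - 4 * ‖w‖ ≤ σ.re ^ 2 := by
  have h1 : 1 - 4 * ‖w‖ ≤ ‖σ‖ ^ 2 := by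
    rw [← norm_pow, h]
    have := norm_sub_norm_le (1 : ℂ) (4 * w)
    simpa using this
  have h2 : σ.re ^ 2 - σ.im ^ 2 = 1 - 4 * w.re := by
    have := congrArg Complex.re h
    simpa [sq] using this
  have h3 : ‖σ‖ ^ 2 = σ.re ^ 2 + σ.im ^ 2 := by
    rw [← Complex.normSq_eq_norm_sq, Complex.normSq_apply]
    ring
  have h4 := Complex.re_le_norm w
  linarith

/-- Bounds for the root `1 - z - g(z)` that is singled out by the principal square root. -/
theorem norm_bounds_of_sqrt {N : ℕ} {z S : ℂ} (hN : 2 ≤ N) (hr1 : ‖z‖ < 1)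
    (hr : N * ‖z‖ < (1 - ‖z‖) * (1 - ‖z‖ ^ 2)) (hS : S ^ 2 = (1 - z) * (1 - z - 4 * N * z ^ 3))
    (hSre : 0 ≤ S.re) :
    N * ‖z‖ < ‖(1 - z + S) / 2‖ ∧ N * ‖z‖ ^ 2 * ‖1 - z‖ < ‖(1 - z + S) / 2‖ := by
  set r := ‖z‖ with hrdef
  have hr0 : 0 ≤ r := norm_nonneg z
  have hN' : (2 : ℝ) ≤ N := by exact_mod_cast hN
  have hNr : N * r < 1 - r := by nlinarith [mul_nonneg (sub_nonneg.2 hr1.le) (sq_nonneg r)]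
  have hr3 : r < 1 / 3 := by nlinarith
  have hu1 : 1 - r ≤ ‖1 - z‖ := by simpa using norm_sub_norm_le (1 : ℂ) z
  have hu : 1 - z ≠ 0 := norm_pos_iff.1 (by linarith)
  set σ := S / (1 - z) with hσ
  set w := N * z ^ 3 / (1 - z) with hw
  have hSσ : S = (1 - z) * σ := by rw [hσ, mul_div_cancel₀ _ hu]
  have hσ2 : σ ^ 2 = 1 - 4 * w := by
    rw [hσ, hw, div_pow, hS]
    field_simp
  have hwn : ‖w‖ ≤ N * r ^ 3 / (1 - r) := by
    rw [hw, norm_div, norm_mul, Complex.norm_natCast, norm_pow]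
    gcongr
  have hω : N * r ^ 3 / (1 - r) ≤ 1 / 9 := by
    rw [div_le_iff₀ (by linarith)]
    nlinarith [mul_nonneg hr0 hr0, mul_le_mul hNr.le (show r ^ 2 ≤ 1 / 9 by nlinarith) (sq_nonneg r) (by linarith)]
  have hre2 := one_sub_le_re_sq hσ2
  -- Since |w| < 1/4, σ lies within 45° of the real axis. As r < 1/3, a negative real part would
  -- survive multiplication by `1 - z` and contradict Re S ≥ 0.
  have hσre : 0 ≤ σ.re := by
    by_contra! hneg
    have him : σ.im ^ 2 ≤ σ.re ^ 2 := by
      have h2 : σ.re ^ 2 - σ.im ^ 2 = 1 - 4 * w.re := by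
        have := congrArg Complex.re hσ2
        simpa [sq] using this
      have := Complex.re_le_norm w
      linarith
    have him' : |σ.im| ≤ -σ.re := by
      rw [← abs_of_neg hneg]
      exact sq_le_sq.1 him
    have h1 := Complex.abs_re_le_norm z
    have h2 := Complex.abs_im_le_norm z
    have h3 : S.re = (1 - z.re) * σ.re + z.im * σ.im := by
      rw [hSσ]
      simp
    have h4 : z.im * σ.im ≤ r * -σ.re := by
      calc z.im * σ.im ≤ |z.im * σ.im| := le_abs_self _
        _ = |z.im| * |σ.im| := abs_mul _ _
        _ ≤ r * -σ.re := mul_le_mul h2 him' (abs_nonneg _) hr0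
    have h5 : z.re ≤ r := (le_abs_self _).trans h1
    nlinarith
  have hC : ‖(1 - z + S) / 2‖ = ‖1 - z‖ * ‖1 + σ‖ / 2 := by
    rw [hSσ, show 1 - z + (1 - z) * σ = (1 - z) * (1 + σ) by ring, norm_div, norm_mul]
    simp
  have h1σ : 1 + σ.re ≤ ‖1 + σ‖ := by
    have := Complex.re_le_norm (1 + σ)
    simpa using this
  rw [hC]
  constructor
  · have hpos : 0 < 1 - r := by linarith
    -- This is the first bound solved for Re σ. When the left side is nonnegative, squaring and
    -- clearing denominators reduces it to `hr` multiplied by a positive factor.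
    have hv : (2 * (N * r) - (1 - r)) / (1 - r) < σ.re := by
      rcases lt_or_ge (2 * (N * r)) (1 - r) with hlt | hge
      · exact lt_of_lt_of_le (div_neg_of_neg_of_pos (by linarith) hpos) hσre
      have h0 : 0 < N * r := by linarith
      refine lt_of_pow_lt_pow_left₀ 2 hσre (lt_of_lt_of_le ?_ hre2)
      refine lt_of_lt_of_le ?_ (sub_le_sub_left (mul_le_mul_of_nonneg_left hwn (by norm_num)) 1)
      rw [← mul_div_assoc, div_pow, lt_sub_iff_add_lt, div_add_div _ _ (by positivity) hpos.ne',
        div_lt_one (by positivity)]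
      nlinarith [mul_pos (mul_pos h0 hpos) (sub_pos.2 hr)]
    rw [div_lt_iff₀ (by linarith)] at hv
    have := mul_le_mul hu1 h1σ (by linarith) (norm_nonneg _)
    nlinarith
  · have hNr2 : N * r ^ 2 < 1 / 2 := by nlinarith
    have hpos : 0 < ‖1 - z‖ := by linarith
    nlinarith

end Root
-- The double series over cyclic patterns
section Series

variable {N : ℕ}

/-- The index set of the double series: cyclic words of symbol types of all positive lengths. -/
abbrev CyclicShape : Type := Σ n : ℕ, ZMod (n + 1) → Shape

open Classical in
/-- The contribution of a cyclic word of symbol types in which the symbols `γ(-)` are labelled. -/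
noncomputable def term (N : ℕ) (z : ℂ) (i : CyclicShape) : ℂ :=
  if Admissible i.2 then z ^ (i.1 + 1) / ((i.1 + 1 : ℕ) : ℂ) * (N : ℂ) ^ count i.2 .minus else 0

/-- The surplus of symbols `γ(-)` over symbols `γ(+)`. -/
def excess (i : CyclicShape) : ℤ := (count i.2 .minus : ℤ) - count i.2 .plus

theorem sum_term_mul_zpow (N : ℕ) (z : ℂ) {y : ℂ} (hy : y ≠ 0) (n : ℕ) :
    ∑ f : ZMod (n + 1) → Shape, term N z ⟨n, f⟩ * y ^ excess ⟨n, f⟩ =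
      z ^ (n + 1) * (transfer (N * y) y⁻¹ ^ (n + 1)).trace / ((n + 1 : ℕ) : ℂ) := by
  classical
  rw [← sum_admissible_eq_trace, Finset.sum_filter, mul_div_right_comm, Finset.mul_sum]
  refine Finset.sum_congr rfl fun f _ => ?_
  simp only [term, excess]
  split_ifs
  · rw [zpow_sub₀ hy, zpow_natCast, zpow_natCast, mul_pow, inv_pow]
    ring
  · simp

theorem pow_mul_pow_toNat (a b N : ℕ) : (N : ℂ) ^ a * (N : ℂ) ^ (-((a : ℤ) - b)).toNat =
    ((N ^ max a b : ℕ) : ℂ) := by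
  rw [← pow_add, Nat.cast_pow]
  congr 1
  omega

theorem sum_term_mul_weight {Γ : Type*} [Finite Γ] [Nonempty Γ] (z : ℂ) (n : ℕ) :
    ∑ f : ZMod (n + 1) → Shape, term (Nat.card Γ) z ⟨n, f⟩ *
      (Nat.card Γ : ℂ) ^ (-excess ⟨n, f⟩).toNat = zetaTerm (shiftX Γ).carrier z n := by
  classical
  rw [zetaTerm, ncard_periodicPoints_shiftX, Finset.sum_filter, Nat.cast_sum, Finset.sum_div,
    Finset.sum_mul]
  refine Finset.sum_congr rfl fun f _ => ?_
  simp only [term, excess]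
  split_ifs
  · rw [← pow_mul_pow_toNat]
    ring
  · simp

/-- Patterns of one length contribute nonnegative multiples of the same power of `z`, so splitting a
zeta term into its patterns loses no absolute convergence. -/
theorem summable_norm_term_mul_weight {Γ : Type*} [Finite Γ] [Nonempty Γ] {z : ℂ}
    (h : Summable (zetaTerm (shiftX Γ).carrier z)) :
    Summable fun i => ‖term (Nat.card Γ) z i * (Nat.card Γ : ℂ) ^ (-excess i).toNat‖ := by
  classical
  rw [summable_sigma_of_nonneg fun _ => norm_nonneg _]
  refine ⟨fun n => (hasSum_fintype _).summable, h.norm.congr fun n => ?_⟩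
  rw [tsum_fintype, zetaTerm, ncard_periodicPoints_shiftX, norm_mul, norm_div, norm_pow,
    Complex.norm_natCast, Finset.sum_filter, Nat.cast_sum, Finset.sum_div, Finset.sum_mul]
  refine Finset.sum_congr rfl fun f _ => ?_
  simp only [term, excess]
  split_ifs
  · rw [mul_assoc, pow_mul_pow_toNat, norm_mul, norm_div, norm_pow, Complex.norm_natCast,
      Complex.norm_natCast]
    ring
  · simp

theorem summable_norm_term {Γ : Type*} [Finite Γ] [Nonempty Γ] {z : ℂ}
    (h : Summable (zetaTerm (shiftX Γ).carrier z)) :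
    Summable fun i => ‖term (Nat.card Γ) z i‖ := by
  refine (summable_norm_term_mul_weight h).of_nonneg_of_le (fun _ => norm_nonneg _) fun i => ?_
  rw [norm_mul, norm_pow, Complex.norm_natCast]
  exact le_mul_of_one_le_right (norm_nonneg _)
    (one_le_pow₀ (by exact_mod_cast Nat.one_le_iff_ne_zero.2 Nat.card_pos.ne'))

theorem summable_term_mul_zpow {z y : ℂ} (h : Summable fun i => ‖term N z i‖) (hy : ‖y‖ = 1) :
    Summable fun i => ‖term N z i * y ^ excess i‖ := by
  refine h.congr fun i => ?_
  rw [norm_mul, norm_zpow, hy, one_zpow, mul_one]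

theorem exp_tsum_term_mul_zpow {z y : ℂ} (h : Summable fun i => ‖term N z i‖) (hy : ‖y‖ = 1) :
    Complex.exp (∑' i, term N z i * y ^ excess i) *
      ((1 - z) * (1 - z ^ 2 * y⁻¹) - N * y * z) = 1 := by
  have hy0 : y ≠ 0 := norm_ne_zero_iff.1 (by rw [hy]; exact one_ne_zero)
  have hs := (summable_term_mul_zpow h hy).of_norm
  have hfiber : ∀ n : ℕ, ∑' f : ZMod (n + 1) → Shape, term N z ⟨n, f⟩ * y ^ excess ⟨n, f⟩ =
      z ^ (n + 1) * (transfer (N * y) y⁻¹ ^ (n + 1)).trace / ((n + 1 : ℕ) : ℂ) := fun n => by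
    rw [tsum_fintype, sum_term_mul_zpow N z hy0]
  have hs' := hs.sigma
  simp_rw [hfiber] at hs'
  rw [hs.tsum_sigma]
  simp_rw [hfiber]
  -- The powers of `z` are absorbed into the power sums, so the identity is needed only at the point
  -- 1.
  have := exp_tsum_mul_eq_one (T := fun n => z ^ (n + 1) * (transfer (N * y) y⁻¹ ^ (n + 1)).trace)
    (e₁ := (1 + N * y) * z) (e₂ := y⁻¹ * z ^ 2) (e₃ := -y⁻¹ * z ^ 3)
    (by simp only [zero_add, pow_one, trace_transfer]; ring)
    (by simp only [zero_add, pow_one, Nat.reduceAdd, trace_transfer, trace_transfer_sq]; ring)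
    (by
      simp only [zero_add, pow_one, Nat.reduceAdd, trace_transfer, trace_transfer_sq,
        trace_transfer_pow_three]
      ring)
    (fun n => by
      simp only [add_assoc, Nat.reduceAdd, trace_transfer_pow_add_four]
      ring) hs'.norm
  refine Eq.trans ?_ this
  congr 1
  ring

theorem term_ofReal (N : ℕ) (r : ℝ) (i : CyclicShape) : ∃ x : ℝ, term N r i = x := by
  classical
  unfold term
  split_ifs
  · exact ⟨r ^ (i.1 + 1) / ((i.1 + 1 : ℕ) : ℝ) * (N : ℝ) ^ count i.2 .minus, by push_cast; rfl⟩
  · exact ⟨0, by simp⟩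

/-- At y = 1 and real `r` the exponent is real, so its exponential is positive, and so is the
reciprocal, the determinant. -/
theorem determinant_pos {r : ℝ} (h : Summable fun i => ‖term N r i‖) :
    N * r < (1 - r) * (1 - r ^ 2) := by
  have h1 := exp_tsum_term_mul_zpow h norm_one
  choose x hx using term_ofReal N r
  simp only [one_zpow, mul_one, inv_one, hx] at h1
  rw [← Complex.ofReal_tsum, ← Complex.ofReal_exp] at h1
  have h2 : Real.exp (∑' i, x i) * ((1 - r) * (1 - r ^ 2) - N * r) = 1 := by exact_mod_cast h1
  by_contra! hle
  have := mul_nonpos_of_nonneg_of_nonpos (Real.exp_pos (∑' i, x i)).le (sub_nonpos.2 hle)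
  linarith

theorem summable_term_of_norm_le {z v : ℂ} (h : Summable fun i => ‖term N z i‖) (hv : ‖v‖ ≤ ‖z‖) :
    Summable fun i => ‖term N v i‖ := by
  refine h.of_nonneg_of_le (fun _ => norm_nonneg _) fun i => ?_
  unfold term
  split_ifs
  · simp only [norm_mul, norm_div, norm_pow]
    gcongr
  · exact le_rfl

theorem norm_lt_one_of_summable {z : ℂ} (h : Summable fun i => ‖term N z i‖) :
    ‖z‖ < 1 := by
  by_contra! hz
  -- At radius 1 the right side vanishes, leaving N < 0.
  have := determinant_pos (N := N) (r := 1) (summable_term_of_norm_le h (by simpa using hz))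
  have h0 : (0 : ℝ) ≤ N := Nat.cast_nonneg N
  norm_num at this
  linarith

theorem determinant_norm_pos {z : ℂ} (h : Summable fun i => ‖term N z i‖) :
    N * ‖z‖ < (1 - ‖z‖) * (1 - ‖z‖ ^ 2) :=
  determinant_pos (summable_term_of_norm_le h (by simp))

end Series

/-! ### Convergence and the closed formula -/

section Main

theorem summable_zetaTerm {Γ : Type*} [Finite Γ] (Y : Set (ℤ → Symbol Γ)) {z : ℂ}
    (hz : ‖z‖ < 1 / (2 * Nat.card Γ + 1)) : Summable (zetaTerm Y z) := by
  have hq : (2 * Nat.card Γ + 1) * ‖z‖ < 1 := by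
    rwa [lt_div_iff₀ (by positivity), mul_comm] at hz
  have hg := (summable_nat_add_iff 1).2 (summable_geometric_of_lt_one (by positivity) hq)
  refine Summable.of_norm_bounded hg fun n => ?_
  have h1 : ((periodicPoints Y (n + 1)).ncard : ℝ) ≤ (2 * Nat.card Γ + 1) ^ (n + 1) := by
    exact_mod_cast ncard_periodicPoints_le Y (n + 1)
  rw [zetaTerm, norm_mul, norm_div, norm_pow, Complex.norm_natCast, Complex.norm_natCast, mul_pow]
  gcongr
  refine (div_le_self (Nat.cast_nonneg _) ?_).trans h1
  exact_mod_cast Nat.le_add_left 1 n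

theorem zeta_shiftX {Γ : Type*} [Finite Γ] (hN : 1 < Nat.card Γ) {z : ℂ}
    (h : Summable (zetaTerm (shiftX Γ).carrier z)) :
    ((1 - (Nat.card Γ + 1) * z - gFun (Nat.card Γ) z) *
        ((1 - Nat.card Γ * z ^ 2) * (1 - z) - gFun (Nat.card Γ) z) ≠ 0) ∧
      zeta (shiftX Γ).carrier z = (1 - z - gFun (Nat.card Γ) z) /
        ((1 - (Nat.card Γ + 1) * z - gFun (Nat.card Γ) z) *
          ((1 - Nat.card Γ * z ^ 2) * (1 - z) - gFun (Nat.card Γ) z)) := by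
  have : Nonempty Γ := (Nat.card_pos_iff.1 (by omega)).1
  have hW := summable_norm_term_mul_weight h
  have hτ := summable_norm_term h
  have hzeta : zeta (shiftX Γ).carrier z = Complex.exp (∑' i, term (Nat.card Γ) z i *
      (Nat.card Γ : ℂ) ^ (-excess i).toNat) := by
    rw [zeta, hW.of_norm.tsum_sigma]
    simp_rw [tsum_fintype, sum_term_mul_weight]
  set N := Nat.card Γ
  set S := Complex.sqrt ((1 - z) * (1 - z - 4 * N * z ^ 3)) with hSdef
  have hS2 : S ^ 2 = (1 - z) * (1 - z - 4 * N * z ^ 3) := sqrt_sq _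
  obtain ⟨hb1, hb2⟩ := norm_bounds_of_sqrt hN (norm_lt_one_of_summable hτ)
    (determinant_norm_pos hτ) hS2 (sqrt_re_nonneg _)
  set C := (1 - z + S) / 2 with hCdef
  have hg : gFun N z = 1 - z - C := by
    rw [gFun, ← hSdef, hCdef]
    ring
  have hCpos : 0 < ‖C‖ := lt_of_le_of_lt (by positivity) hb1
  have hC : C ≠ 0 := norm_pos_iff.1 hCpos
  clear_value S C
  have hroot : C ^ 2 - (1 - z) * C + N * z ^ 3 * (1 - z) = 0 := by
    rw [hCdef]
    linear_combination hS2 / 4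
  -- `p` and `q` match the coefficients of y and 1/y in the determinant; the quadratic equation for
  -- `C` then matches the constant one, C(1 + pq) = 1 - z.
  set p := N * z / C with hp
  set q := (1 - z) * z ^ 2 / C with hq
  clear_value p q
  have hCp : C * p = N * z := by rw [hp, mul_div_cancel₀ _ hC]
  have hCq : C * q = (1 - z) * z ^ 2 := by rw [hq, mul_div_cancel₀ _ hC]
  have hp1 : ‖p‖ < 1 := by
    rw [hp, norm_div, norm_mul, Complex.norm_natCast, div_lt_one hCpos]
    exact hb1
  have hqN : ‖q * N‖ < 1 := by
    rw [hq, norm_mul, norm_div, norm_mul, norm_pow, Complex.norm_natCast, div_mul_eq_mul_div,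
      div_lt_one hCpos]
    linarith
  have hq1 : ‖q‖ < 1 := by
    refine lt_of_le_of_lt ?_ hqN
    rw [norm_mul, Complex.norm_natCast]
    exact le_mul_of_one_le_right (norm_nonneg _) (by exact_mod_cast hN.le)
  have hCpq : C * p * q = 1 - z - C := by
    refine mul_left_cancel₀ hC ?_
    linear_combination (C * q) * hCp + N * z * hCq + hroot
  -- The weight N^max(-k,0) restores N^max(a,b) on the side of the patterns and replaces `q` by `q *
  -- N` on the side of the logarithm.
  have key := exp_weighted_eq (τ := term N z) (κ := excess) (M := logCoeff C p q)
    (W := fun k => (N : ℂ) ^ (-k).toNat) hτ (hasSum_logCoeff C hp1 hq1).summable.norm (by simp)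
    hW.of_norm (by
      simp_rw [logCoeff_mul_pow_toNat]
      exact (hasSum_logCoeff C hp1 hqN).summable) fun y hy => by
    have hy0 : y ≠ 0 := norm_ne_zero_iff.1 (by rw [hy]; exact one_ne_zero)
    simp_rw [logCoeff_mul_zpow]
    rw [exp_tsum_logCoeff hC (by rwa [norm_mul, hy, mul_one])
      (by rwa [norm_mul, norm_inv, hy, inv_one, mul_one])]
    refine eq_inv_of_mul_eq_one_left ?_
    refine Eq.trans ?_ (exp_tsum_term_mul_zpow hτ hy)
    congr 1
    linear_combination -y * hCp - y⁻¹ * hCq + y * y⁻¹ * hCpq + (1 - z - C) * mul_inv_cancel₀ hy0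
  simp_rw [logCoeff_mul_pow_toNat] at key
  rw [exp_tsum_logCoeff hC hp1 hqN] at key
  have hne : ∀ {a : ℂ}, ‖a‖ < 1 → 1 - a ≠ 0 := fun {a} ha h => by
    rw [← sub_eq_zero.1 h, norm_one] at ha
    exact lt_irrefl _ ha
  have e1 : 1 - (N + 1) * z - gFun N z = C * (1 - p) := by
    rw [hg]
    linear_combination hCp
  have e2 : (1 - N * z ^ 2) * (1 - z) - gFun N z = C * (1 - q * N) := by
    rw [hg]
    linear_combination N * hCq
  have e3 : 1 - z - gFun N z = C := by
    rw [hg]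
    ring
  rw [e1, e2, e3, hzeta, key]
  have := hne hp1
  have := hne hqN
  refine ⟨by positivity, ?_⟩
  field_simp

end Main

end MotzkinSubshift

theorem proposition5p2 {Γ : Type*} [Fintype Γ] (N : ℕ) (hN : N = Fintype.card Γ) (hN1 : 1 < N) :
    (∀ z : ℂ, ‖z‖ < 1 / (2 * N + 1) →
      Summable (MotzkinSubshift.zetaTerm (MotzkinSubshift.shiftX Γ).carrier z)) ∧
    ∀ z : ℂ, Summable (MotzkinSubshift.zetaTerm (MotzkinSubshift.shiftX Γ).carrier z) →
      ((1 - (N + 1) * z - MotzkinSubshift.gFun N z) *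
        ((1 - N * z ^ 2) * (1 - z) - MotzkinSubshift.gFun N z) ≠ 0) ∧
      MotzkinSubshift.zeta (MotzkinSubshift.shiftX Γ).carrier z =
        (1 - z - MotzkinSubshift.gFun N z) /
          ((1 - (N + 1) * z - MotzkinSubshift.gFun N z) *
            ((1 - N * z ^ 2) * (1 - z) - MotzkinSubshift.gFun N z)) := by
  rw [← Nat.card_eq_fintype_card] at hN
  subst hN
  exact ⟨fun z hz => MotzkinSubshift.summable_zetaTerm _ hz,
    fun z hz => MotzkinSubshift.zeta_shiftX hN1 hz⟩
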